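/- **Setting.** Let $\Phi=\{j\pi/4 : j=0,\dots,7\}$ (angles modulo $2\pi$), $\mathsf R_Z(\theta)=e^{-i\theta \mathsf Z/2}$, and let $a_\theta^\dagger=(a_L^\dagger+e^{i\theta}a_R^\dagger)/\sqrt2$ be the rotated creation operator on the two polarisation modes $L,R$ (with $|\!\downarrow\rangle,|L\rangle$ identified with $|0\rangle$ and $|\!\uparrow\rangle,|R\rangle$ with $|1\rangle$). Write $|k\rangle_\theta=(a_\theta^\dagger)^k|\mathrm{vac}\rangle/\sqrt{k!}$, so that $|1\rangle_\theta=|+_\theta\rangle$, and $$\rho_{\alpha,\theta}=e^{-|\alpha|^2}\sum_{k\ge 0}\frac{|\alpha|^{2k}}{k!}\,|k\rangle\langle k|_\theta$$ for the phase-randomised weak coherent pulse. Let $E_{qe}=|\!\downarrow,L\rangle\langle\downarrow\!|+|\!\uparrow,R\rangle\langle\uparrow\!|$ and let $E_{qe}(\theta)=\mathsf R_Z(\theta)E_{qe}$, where $\mathsf R_Z$ acts on the photon. **Resource (Blind Graph State Extender).** Alice inputs $\theta\in\Phi$, Bob inputs a qubit state $\rho_B$. The resource draws a uniform bit $b$ and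 sends to Bob $b$ and the two-qubit state $\mathsf R_Z((-1)^b\theta)\,\mathsf{CNOT}(\rho_B\otimes|0\rangle\langle 0|)$, with $\mathsf R_Z$ on the second qubit. **Protocol** (parameters $\alpha\in\mathbb C$, $n\ge 1$). Alice inputs $\theta\in\Phi$, Bob inputs a spin qubit. 1. Alice draws $\theta_1,\dots,\theta_{n-1}\in\Phi$ and a bit $m_x$ uniformly at random and sets $\theta_n=(-1)^{m_x}\theta-\sum_{i<n}\theta_i$. 2. For $i=1,\dots,n$, Alice sends $\rho_{\alpha,\theta_i}$ and Bob lets this pulse drive his emitter. 3. Alice sends $m_x$. Bob emits one more photon (number $0$) with $E_{qe}$ and attempts to measure the photons $1,\dots,n$ in the $|\pm\rangle$ basis. If a photon is missing, he sends $\mathsf{Abort}$ to Alice and outputs $\mathsf{Abort}$. Otherwise he applies $\mathsf Z^{b}$ to photon $0$, where $b$ is the parity of the outcomes, and outputs $m_x$, the spin and photon $0$. Alice has no output. **Emitter.** Bob's emitter has efficiency $\eta_1$: for every $\theta\in\Phi$, under a pulse $\rho_{\alpha,\theta}$ the spin evolves by a CPTP map that produces a photon with probability $\eta_1$, in which case exactly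 $E_{qe}(\theta)$ has been applied to the spin; nothing is assumed about the spin when no photon is produced. Emitted photons are not lost afterwards. **Security notion.** Two resources are $\epsilon$-indistinguishable if $|\Pr[b=1\mid b\leftarrow\mathcal D\mathcal R_0]-\Pr[b=1\mid b\leftarrow\mathcal D\mathcal R_1]|\le\epsilon$ for every (computationally unbounded) distinguisher $\mathcal D$, that is, every sequence of CPTP maps with quantum memory which interacts with all the interfaces and outputs a bit $b$. A protocol $(\pi_A,\pi_B)$ $\epsilon$-constructs a resource $\mathcal S$ (against dishonest Bob, from perfect communication channels $\mathcal R$) if $\pi_A\mathcal R\pi_B$ and $\mathcal S$ are $\epsilon$-indistinguishable, and there is a simulator $\sigma_B$, a sequence of CPTP maps attached to Bob's interface of $\mathcal S$, such that $\pi_A\mathcal R$ and $\mathcal S\sigma_B$ are $\epsilon$-indistinguishable. **Theorem (AC security of the post-selected privacy amplification protocol).** Let $p_{\alpha,2}=1-e^{-|\alpha|^2}-|\alpha|^2e^{-|\alpha|^2}$ be the probability that a pulse contains two or more photons. Then the protocol above $\epsilon'$-constructs the Blind Graph State Extender in the Abstract Cryptography framework, for $$\epsilon'=\max\bigl(1-\eta_1^n,\;p_{\alpha,2}^n\bigr).$$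 -/

import Mathlib

open scoped ComplexOrder Kronecker Matrix

noncomputable section

namespace BlindGraph

/-! ### Quantum systems, density operators, CPTP maps

A quantum system with orthonormal basis `X` (of any cardinality) is the Hilbert space `ℓ²(X)`; its
operators are given by their matrices in that basis. A classical register is a system whose states
are diagonal. -/

/-- A positive trace class operator on `ℓ²(X)`. -/
def IsPosTraceClass {X : Type} (ρ : Matrix X X ℂ) : Prop :=
  ρ.PosSemidef ∧ Summable fun x => ρ x x

/-- A density operator on `ℓ²(X)`. -/
def IsDensity {X : Type} (ρ : Matrix X X ℂ) : Prop :=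
  ρ.PosSemidef ∧ HasSum (fun x => ρ x x) 1

/-- A linear map on operators. Only its values on trace class operators (the linear span of the
positive ones) ever matter; a linear map given on these always extends to all matrices. -/
abbrev Superop (X Y : Type) : Type := Matrix X X ℂ →ₗ[ℂ] Matrix Y Y ℂ

/-- Pull the matrix back along a map of basis labels: a relabelling of the basis when `f` is a
bijection, the compression to a sub-block when `f` is injective. -/
def compress {X Y : Type} (f : Y → X) : Superop X Y where
  toFun M := M.submatrix f f
  map_add' _ _ := rfl
  map_smul' _ _ := rfl

/-- `Φ ⊗ id_W`. -/
def onLeft {X Y : Type} (W : Type) (Φ : Superop X Y) : Superop (X × W) (Y × W) where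
  toFun M := fun p q => Φ (fun x x' => M (x, p.2) (x', q.2)) p.1 q.1
  map_add' M N := by
    ext p q
    exact congrFun (congrFun (Φ.map_add (fun x x' => M (x, p.2) (x', q.2))
      (fun x x' => N (x, p.2) (x', q.2))) p.1) q.1
  map_smul' c M := by
    ext p q
    exact congrFun (congrFun (Φ.map_smul c (fun x x' => M (x, p.2) (x', q.2))) p.1) q.1

/-- `id_W ⊗ Φ`. -/
def onRight {X Y : Type} (W : Type) (Φ : Superop X Y) : Superop (W × X) (W × Y) :=
  compress Prod.swap ∘ₗ onLeft W Φ ∘ₗ compress Prod.swap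

/-- Completely positive and trace preserving (on trace class operators). -/
def IsCPTP {X Y : Type} (Φ : Superop X Y) : Prop :=
  (∀ (k : ℕ) (M : Matrix (X × Fin k) (X × Fin k) ℂ), IsPosTraceClass M →
      (onLeft (Fin k) Φ M).PosSemidef) ∧
    ∀ (ρ : Matrix X X ℂ) (t : ℂ), ρ.PosSemidef → HasSum (fun x => ρ x x) t →
      HasSum (fun y => Φ ρ y y) t

/-- `|x⟩⟨x|`. -/
def ketbra {X : Type} [DecidableEq X] (x : X) : Matrix X X ℂ := Matrix.single x x 1

/-- `ρ ↦ K ρ K†`. -/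
def conj {X Y : Type} [Fintype X] (K : Matrix Y X ℂ) : Superop X Y where
  toFun M := K * M * Kᴴ
  map_add' M N := by rw [Matrix.mul_add, Matrix.add_mul]
  map_smul' c M := by simp

/-- `ρ ↦ ρ ⊗ τ`. -/
def tensorRight {X Y : Type} (τ : Matrix Y Y ℂ) : Superop X (X × Y) where
  toFun M := M ⊗ₖ τ
  map_add' M N := Matrix.add_kronecker M N τ
  map_smul' c M := Matrix.smul_kronecker c M τ

/-- `ρ ↦ τ ⊗ ρ`. -/
def tensorLeft {X Y : Type} (τ : Matrix Y Y ℂ) : Superop X (Y × X) where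
  toFun M := τ ⊗ₖ M
  map_add' M N := Matrix.kronecker_add τ M N
  map_smul' c M := Matrix.kronecker_smul c τ M

/-- Measure in the standard basis and, on outcome `x`, prepare `σ x`. -/
def measurePrepare {X Y : Type} [Fintype X] (σ : X → Matrix Y Y ℂ) : Superop X Y where
  toFun M := ∑ x, M x x • σ x
  map_add' M N := by simp [add_smul, Finset.sum_add_distrib]
  map_smul' c M := by simp [Finset.smul_sum, mul_smul]

/-! ### Abstract Cryptography for two parties, with Bob possibly dishonest

An interaction is described by the list of its rounds. In a round with entry `(o, i)`, a system `o`
goes from Alice's side to Bob's side, and then a system `i` goes back. -/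

/-- A sequence of maps with internal memory that plays the Alice side of the rounds `l`, starting
from memory (or input) `A`. This is also a two-party resource with input `A`, whose rounds `l` take
place at Bob's interface; the memory left at the end is not accessible from outside. -/
inductive Sender : List (Type × Type) → Type → Type 1
  | done {A : Type} : Sender [] A
  | send {A A' o i : Type} {l : List (Type × Type)} (s : Superop A (A' × o))
      (S : Sender l (A' × i)) : Sender ((o, i) :: l) A

/-- A sequence of maps with internal memory that plays the Bob side of the rounds `l`, starting
from memory (or input) `B` and ending with an output `O`. -/
inductive Responder : List (Type × Type) → Type → Type → Type 1
  | done {B O : Type} (f : Superop B O) : Responder [] B O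
  | recv {B B' O o i : Type} {l : List (Type × Type)} (r : Superop (B × o) (B' × i))
      (R : Responder l B' O) : Responder ((o, i) :: l) B O

/-- All maps in the sequence are CPTP. -/
def Sender.IsPhysical : {l : List (Type × Type)} → {A : Type} → Sender l A → Prop
  | _, _, .done => True
  | _, _, .send s S => IsCPTP s ∧ S.IsPhysical

/-- All maps in the sequence are CPTP. -/
def Responder.IsPhysical : {l : List (Type × Type)} → {B O : Type} → Responder l B O → Prop
  | _, _, _, .done f => IsCPTP f
  | _, _, _, .recv r R => IsCPTP r ∧ R.IsPhysical

/-- Apply `f` to the input first. -/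
def Sender.pre {l : List (Type × Type)} {A A₀ : Type} (S : Sender l A) (f : Superop A₀ A) :
    Sender l A₀ :=
  match S with
  | .done => .done
  | .send s S' => .send (s ∘ₗ f) S'

/-- Apply `f` to the input first. -/
def Responder.pre {l : List (Type × Type)} {B B₀ O : Type} (R : Responder l B O)
    (f : Superop B₀ B) : Responder l B₀ O :=
  match R with
  | .done g => .done (g ∘ₗ f)
  | .recv r R' => .recv (r ∘ₗ onLeft _ f) R'

/-- Run the two sides of an interaction against each other. The result is a map from the joint
input `A × B` to `F × O`, where `F` is the memory left on Alice's side. -/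
def interact : {l : List (Type × Type)} → {A B O : Type} → Sender l A → Responder l B O →
    Σ F : Type, Superop (A × B) (F × O)
  | _, A, _, _, .done, .done f => ⟨A, onRight A f⟩
  | _, _, B, _, .send (A' := A') (o := o) (i := i) s S, .recv (B' := B') r R =>
      ⟨(interact S R).1,
        (interact S R).2
          ∘ₗ compress (fun x : (A' × i) × B' => (x.1.1, (x.2, x.1.2)))
          ∘ₗ onRight A' r
          ∘ₗ compress (fun x : A' × (B × o) => ((x.1, x.2.2), x.2.1))
          ∘ₗ onLeft B s⟩

/-- The resource which takes its whole input at once, applies `T`, and outputs `O` while keeping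
`F`. -/
def oneShot {A F O : Type} (T : Superop A (F × O)) : Sender [(O, Unit)] A :=
  .send T .done

/-- A distinguisher for resources with input `A` and rounds `l`: it prepares the input, possibly
entangled with its own memory `W`, takes part in all rounds, and outputs a bit. -/
structure Distinguisher (l : List (Type × Type)) (A : Type) where
  W : Type
  init : Matrix (A × W) (A × W) ℂ
  strategy : Responder l W Bool

/-- The distinguisher prepares a state and applies CPTP maps. -/
def Distinguisher.IsPhysical {l : List (Type × Type)} {A : Type} (D : Distinguisher l A) : Prop :=
  IsDensity D.init ∧ D.strategy.IsPhysical

/-- `Pr[b = 1 | b ← D R]`. -/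
def probOne {l : List (Type × Type)} {A : Type} (D : Distinguisher l A) (R : Sender l A) : ℝ :=
  ∑' f, ((interact R D.strategy).2 D.init (f, true) (f, true)).re

/-- `ε`-statistical indistinguishability of two resources with the same interfaces. -/
def Indist {l : List (Type × Type)} {A : Type} (ε : ℝ) (R₀ R₁ : Sender l A) : Prop :=
  ∀ D : Distinguisher l A, D.IsPhysical → |probOne D R₀ - probOne D R₁| ≤ ε

/-- A simulator attached to Bob's interface of a one-call functionality with Bob input `B` and
Bob output `O`, which emulates the rounds `l`: it prepares a state on `B × K`, inputs `B`, keeps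
`K`, receives `O`, and then plays the rounds. -/
structure Simulator (l : List (Type × Type)) (B O : Type) where
  K : Type
  prep : Matrix (B × K) (B × K) ℂ
  strategy : Sender l (O × K)

/-- The simulator prepares a state and applies CPTP maps. -/
def Simulator.IsPhysical {l : List (Type × Type)} {B O : Type} (σ : Simulator l B O) : Prop :=
  IsDensity σ.prep ∧ σ.strategy.IsPhysical

/-- The resource `S σ_B`, with input `A` at Alice's interface and rounds `l` at Bob's. -/
def Simulator.attach {l : List (Type × Type)} {A B O : Type} (S : Superop (A × B) O)
    (σ : Simulator l B O) : Sender l A :=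
  σ.strategy.pre (onLeft σ.K S
    ∘ₗ compress (fun x : (A × B) × σ.K => (x.1.1, (x.1.2, x.2)))
    ∘ₗ tensorRight σ.prep)

/-- The protocol `(π_A, π_B)`, run over perfect communication channels carrying the rounds `l`,
`ε`-constructs against dishonest Bob the functionality `S`, which has an input `A` from Alice, an
input `B` from Bob and an output `O` to Bob. -/
def Constructs {l : List (Type × Type)} {A B O : Type} (ε : ℝ) (πA : Sender l A)
    (πB : Responder l B O) (S : Superop (A × B) O) : Prop :=
  Indist ε (oneShot (interact πA πB).2) (oneShot (tensorLeft (ketbra ()) ∘ₗ S)) ∧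
    ∃ σ : Simulator l B O, σ.IsPhysical ∧ Indist ε πA (σ.attach S)

/-! ### Angles, qubits, gates

The angle set `Φ = {jπ/4 | j = 0, …, 7}`, taken modulo `2π`, is `ZMod 8`. A qubit has basis `Bool`,
with `false` for `|0⟩ = |↓⟩ = |L⟩` and `true` for `|1⟩ = |↑⟩ = |R⟩`. -/

/-- The angle `jπ/4`. -/
def angle (j : ZMod 8) : ℝ := j.val * (Real.pi / 4)

/-- `(-1)^b θ`. -/
def signed (b : Bool) (θ : ZMod 8) : ZMod 8 := (-1) ^ b.toNat * θ

/-- `R_Z(θ) = exp(-iθZ/2)`. -/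
def rotZ (θ : ℝ) : Matrix Bool Bool ℂ :=
  Matrix.diagonal fun b =>
    if b then Complex.exp (Complex.I * (θ / 2)) else Complex.exp (-Complex.I * (θ / 2))

/-- Pauli `Z`. -/
def pauliZ : Matrix Bool Bool ℂ := Matrix.diagonal fun b => if b then -1 else 1

/-- `CNOT`, the first qubit being the control. -/
def cnot : Matrix (Bool × Bool) (Bool × Bool) ℂ :=
  Matrix.of fun x y => if x = (y.1, xor y.1 y.2) then 1 else 0

/-- The emission operator `E_qe = |↓,L⟩⟨↓| + |↑,R⟩⟨↑|`, from spin to spin and photon. -/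
def emission : Matrix (Bool × Bool) Bool ℂ :=
  Matrix.of fun x s => if x = (s, s) then 1 else 0

/-- The rotated emission operator `E_qe(θ) = R_Z(θ) E_qe`. -/
def rotatedEmission (θ : ℝ) : Matrix (Bool × Bool) Bool ℂ :=
  ((1 : Matrix Bool Bool ℂ) ⊗ₖ rotZ θ) * emission

/-- The inclusion of a system into the same system extended by one extra basis state `none`. -/
def someEmbed (X : Type) [DecidableEq X] : Matrix (Option X) X ℂ :=
  Matrix.of fun o x => if o = some x then 1 else 0

/-! ### The Blind Graph State Extender -/

/-- Bob's output: the bit `b`, the spin and the photon. The extra basis state `none` is the symbol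
`Abort`, which only occurs in a protocol. -/
abbrev BobOutput : Type := Option (Bool × (Bool × Bool))

/-- The Blind Graph State Extender: on `θ` from Alice and a qubit `ρ` from Bob, it draws a uniform
bit `b` and sends `b` and `R_Z((-1)^b θ) CNOT (ρ ⊗ |0⟩⟨0|)` to Bob, `R_Z` acting on the second
qubit. -/
def graphStateExtender : Superop (ZMod 8 × Bool) BobOutput :=
  ∑ θ : ZMod 8, ∑ b : Bool, (1 / 2 : ℂ) •
    (conj (someEmbed _)
      ∘ₗ tensorLeft (ketbra b)
      ∘ₗ conj (((1 : Matrix Bool Bool ℂ) ⊗ₖ rotZ (angle (signed b θ))) * cnot)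
      ∘ₗ tensorRight (ketbra false)
      ∘ₗ compress (fun s : Bool => (θ, s)))

/-! ### Weak coherent pulses -/

/-- The basis of the two-mode Fock space: photon numbers of the modes `L` and `R`. -/
abbrev Fock : Type := ℕ × ℕ

/-- The vacuum. -/
def vacuum : Fock → ℂ := fun p => if p = (0, 0) then 1 else 0

/-- The rotated creation operator `a_θ† = (a_L† + e^{iθ} a_R†) / √2`. -/
def creation (θ : ℝ) (ψ : Fock → ℂ) : Fock → ℂ := fun p =>
  ((Real.sqrt p.1 : ℂ) * ψ (p.1 - 1, p.2)
    + Complex.exp (Complex.I * θ) * ((Real.sqrt p.2 : ℂ) * ψ (p.1, p.2 - 1))) / (Real.sqrt 2 : ℂ)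

/-- The state `|k⟩_θ = (a_θ†)^k |vac⟩ / √(k!)` of `k` photons, each in the state `|+_θ⟩`. -/
def photons (k : ℕ) (θ : ℝ) : Fock → ℂ := fun p =>
  (creation θ)^[k] vacuum p / (Real.sqrt k.factorial : ℂ)

/-- The phase-randomised rotated weak coherent pulse
`ρ_{α,θ} = e^{-|α|²} ∑ₖ (|α|^{2k} / k!) |k⟩⟨k|_θ`. -/
def pulse (α : ℂ) (θ : ℝ) : Matrix Fock Fock ℂ := fun p q =>
  ∑' k : ℕ, ((Real.exp (-‖α‖ ^ 2) * ‖α‖ ^ (2 * k) / k.factorial : ℝ) : ℂ)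
    * (photons k θ p * star (photons k θ q))

/-- The probability that a pulse contains at least two photons. -/
def probMulti (α : ℂ) : ℝ :=
  1 - Real.exp (-‖α‖ ^ 2) - ‖α‖ ^ 2 * Real.exp (-‖α‖ ^ 2)

/-- `𝓔` describes the interaction of a pulse with Bob's emitter. The result is the spin and the mode
of the emitted photon, whose basis is `none` (no photon), `some false` (`L`), `some true` (`R`).
A pulse `ρ_{α,θ}` produces a photon with probability `η`, and then the rotated emission operator
`E_qe(θ)` has been applied to the spin. Nothing is assumed on the state of the spin otherwise.
For each angle the effective evolution of the spin is CPTP. It is not required that `𝓔` is CPTP on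
all of the Fock space (where only the pulses `ρ_{α,θ}` occur): this covers CPTP devices as well as
the semi-classical idealisation of the emitter, which can have any efficiency `η` in `[0, 1]`. -/
structure IsEmitter (α : ℂ) (η : ℝ) (𝓔 : Superop (Fock × Bool) (Bool × Option Bool)) : Prop where
  cptp : ∀ θ : ZMod 8, IsCPTP (𝓔 ∘ₗ tensorLeft (pulse α (angle θ)))
  emits : ∀ (θ : ZMod 8) (ρ : Matrix Bool Bool ℂ),
    compress (Prod.map id some) (𝓔 (pulse α (angle θ) ⊗ₖ ρ))
      = (η : ℂ) • conj (rotatedEmission (angle θ)) ρ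

/-! ### The post-selected privacy amplification protocol -/

/-- The rounds of the protocol: `n` pulses from Alice, with no answer, then one bit from Alice,
answered by a bit of Bob, with value `true` for `Abort`. -/
def rounds : ℕ → List (Type × Type)
  | 0 => [(Bool, Bool)]
  | n + 1 => (Fock, Unit) :: rounds n

/-- The angles of the `n` pulses: `t` for all but the last, and `(-1)^m θ - ∑ t` for the last. -/
def pulseAngles (n : ℕ) (θ : ZMod 8) (m : Bool) (t : Fin (n - 1) → ZMod 8) : Fin n → ZMod 8 :=
  fun i => if h : (i : ℕ) < n - 1 then t ⟨i, h⟩ else signed m θ - ∑ j, t j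

/-- Alice reads her input `θ`, and draws `m_x` and all angles but the last uniformly at random. -/
def aliceSample (n : ℕ) : Superop (ZMod 8) ((Fin n → ZMod 8) × Bool) :=
  measurePrepare fun θ => ∑ m : Bool, ∑ t : Fin (n - 1) → ZMod 8,
    (1 / (2 * 8 ^ (n - 1)) : ℂ) • ketbra (pulseAngles n θ m t, m)

/-- Alice sends the pulses with the angles in her memory one after the other, then `m_x`. She
ignores a final message of Bob and has no output. -/
def aliceSend (α : ℂ) : (n : ℕ) → Sender (rounds n) ((Fin n → ZMod 8) × Bool)
  | 0 => .send (A' := Unit) (measurePrepare fun x => ketbra ((), x.2)) .done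
  | n + 1 => .send
      (measurePrepare fun x => ketbra (Fin.tail x.1, x.2) ⊗ₖ pulse α (angle (x.1 0)))
      ((aliceSend α n).pre (compress fun y => (y, ())))

/-- Alice's converter. -/
def alice (α : ℂ) (n : ℕ) : Sender (rounds n) (ZMod 8) :=
  (aliceSend α n).pre (aliceSample n)

/-- The modes of the first `k` photons (each possibly vacuum). -/
abbrev Modes (k : ℕ) : Type := Fin k → Option Bool

/-- Amplitude of the outcome `r` of an attempted `|±⟩` measurement of one mode in basis state `x`:
outcome `none` if there is no photon, and outcome `some b` for `(|0⟩ + (-1)^b |1⟩) / √2`. -/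
def detectorAmp : Option Bool → Option Bool → ℂ
  | none, none => 1
  | some b, some x => (if b && x then -1 else 1) / (Real.sqrt 2 : ℂ)
  | _, _ => 0

/-- Attempted `|±⟩` measurement of all modes, giving the classical record of the outcomes. -/
def measureModes (k : ℕ) : Superop (Modes k) (Modes k) :=
  ∑ r : Modes k, conj (Matrix.of fun r' x => if r' = r then ∏ i, detectorAmp (r i) (x i) else 0)

/-- The parity of the outcomes. -/
def parity {k : ℕ} (r : Modes k) : ℕ := (Finset.univ.filter fun i => r i = some true).card % 2

/-- Bob's last step, given the outcome record `r` and the bit `m`: if a photon is missing he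
outputs `Abort` and sends `Abort`; otherwise he applies `Z^b` to his last photon and outputs `m`,
the spin and this photon. -/
def bobConclude (k : ℕ) : Superop (((Bool × Bool) × Modes k) × Bool) (BobOutput × Bool) :=
  ∑ r : Modes k, ∑ m : Bool,
    (if ∃ i, r i = none then
        measurePrepare fun _ => ketbra ((none : BobOutput), true)
      else
        tensorRight (ketbra false)
          ∘ₗ conj (someEmbed _)
          ∘ₗ tensorLeft (ketbra m)
          ∘ₗ conj ((1 : Matrix Bool Bool ℂ) ⊗ₖ pauliZ ^ parity r))
      ∘ₗ compress (fun q : Bool × Bool => ((q, r), m))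

/-- Bob's converter from the moment when he holds the spin and the modes of the first `k` photons
and `j` pulses are still to come: each pulse drives the emitter `𝓔`. After the bit from Alice he
emits one more photon, attempts to measure all earlier ones, and concludes. -/
def bobFrom (𝓔 : Superop (Fock × Bool) (Bool × Option Bool)) :
    (j k : ℕ) → Responder (rounds j) (Bool × Modes k) BobOutput
  | 0, k => .recv
      (bobConclude k
        ∘ₗ onLeft Bool (onRight (Bool × Bool) (measureModes k))
        ∘ₗ onLeft Bool (onLeft (Modes k) (conj emission)))
      (.done LinearMap.id)
  | j + 1, k => .recv
      (compress (fun x : (Bool × Modes (k + 1)) × Unit =>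
          ((x.1.1, x.1.2 (Fin.last k)), fun i : Fin k => x.1.2 i.castSucc))
        ∘ₗ onLeft (Modes k) 𝓔
        ∘ₗ compress (fun x : (Fock × Bool) × Modes k => ((x.1.2, x.2), x.1.1)))
      (bobFrom 𝓔 j (k + 1))

/-- Bob's converter, with the initial spin state as input. -/
def bob (𝓔 : Superop (Fock × Bool) (Bool × Option Bool)) (n : ℕ) :
    Responder (rounds n) Bool BobOutput :=
  (bobFrom 𝓔 n 0).pre (compress fun x => x.1)

end BlindGraph

end

/-!
The two terms of the maximum have independent proofs.

**Honest Bob.** Fix all angles and let `φ` be their sum, which is `(-1)^m θ`. If no photon is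
missing, the emission operators `E_qe(θ_i)` have put the spin and the photons in a GHZ-like state in
which all rotations act on the common basis label, so that only `φ` matters (`IsChain`). The `|±⟩`
measurement of the first `n` photons leaves a sign, which `Z ^ b` removes (`finalStep_some`).
Hence the honest protocol outputs `η ^ n` times the output of the ideal resource, plus an aborting
part that is positive of trace `1 - η ^ n` (`IsEmitter.posTrace_abort`). A measurement can tell the
two apart with advantage at most `1 - η ^ n`.

**Dishonest Bob.** A pulse is the sum of a part with at most one photon and a part with at least two
photons, of trace `p = p_{α,2}`. The former can be prepared from a single copy of the qubit `|+_θ⟩`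
(`encode_plus`). The simulator inputs `|+⟩` to the Blind Graph State Extender and, by measuring the
spin in the basis `|±⟩`, brings the photon into the state `|+_φ⟩` with `φ = (-1)^b θ`
(`disentangle_emission_plus`). It draws the photon numbers of the pulses up to the first pulse with
at most one photon, chooses the angles of all other pulses freely, and encodes in that pulse the
qubit rotated back by all the other angles (`simModes`). If there is such a pulse, the angles are
distributed as in the protocol, namely uniformly among those with sum `φ`. So the real and the
simulated messages differ by `B - C`, where `B` and `C` are the averages over the angles with sum `φ`
and over all angles of the product of the parts with at least two photons (`simModes_plus`). Both
have trace `p ^ n`, so that the two probabilities of any distinguisher differ by at most `p ^ n`.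

In both parts Alice is a mixture of senders with fixed bit and angles (`prob_alice`). Positive
operators and completely positive maps are handled together with the factor by which they rescale the
trace (`PosTrace`, `CPScaling`), so that sub-normalised parts of states need no separate treatment.
-/

noncomputable section

namespace BlindGraph

/-! ### Matrix entries -/

theorem compress_def {X Y : Type} (f : Y → X) (M : Matrix X X ℂ) :
    compress f M = M.submatrix f f := rfl

theorem compress_apply {X Y : Type} (f : Y → X) (M : Matrix X X ℂ) (p q : Y) :
    compress f M p q = M (f p) (f q) := rfl

theorem onLeft_apply {X Y W : Type} (Φ : Superop X Y) (M : Matrix (X × W) (X × W) ℂ)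
    (p q : Y × W) : onLeft W Φ M p q = Φ (M.submatrix (·, p.2) (·, q.2)) p.1 q.1 := rfl

theorem onRight_apply {X Y W : Type} (Φ : Superop X Y) (M : Matrix (W × X) (W × X) ℂ)
    (p q : W × Y) : onRight W Φ M p q = Φ (M.submatrix (p.1, ·) (q.1, ·)) p.2 q.2 := rfl

theorem tensorLeft_apply {X Y : Type} (τ : Matrix Y Y ℂ) (M : Matrix X X ℂ) (p q : Y × X) :
    tensorLeft τ M p q = τ p.1 q.1 * M p.2 q.2 := rfl

theorem tensorRight_apply {X Y : Type} (τ : Matrix Y Y ℂ) (M : Matrix X X ℂ) (p q : X × Y) :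
    tensorRight τ M p q = M p.1 q.1 * τ p.2 q.2 := rfl

theorem conj_apply {X Y : Type} [Fintype X] (K : Matrix Y X ℂ) (M : Matrix X X ℂ) (p q : Y) :
    conj K M p q = ∑ x', (∑ x, K p x * M x x') * star (K q x') := rfl

theorem measurePrepare_apply {X Y : Type} [Fintype X] (σ : X → Matrix Y Y ℂ) (M : Matrix X X ℂ) :
    measurePrepare σ M = ∑ x, M x x • σ x := rfl

theorem onLeft_comp {X Y Z : Type} (W : Type) (Ψ : Superop Y Z) (Φ : Superop X Y) :
    onLeft W (Ψ ∘ₗ Φ) = onLeft W Ψ ∘ₗ onLeft W Φ := rfl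

theorem onLeft_add {X Y : Type} (W : Type) (Φ Ψ : Superop X Y) :
    onLeft W (Φ + Ψ) = onLeft W Φ + onLeft W Ψ := rfl

theorem onLeft_sum {X Y ι : Type} (W : Type) (s : Finset ι) (Φ : ι → Superop X Y) :
    onLeft W (∑ i ∈ s, Φ i) = ∑ i ∈ s, onLeft W (Φ i) := by
  ext M p q
  simp only [onLeft_apply, LinearMap.sum_apply, Matrix.sum_apply]

/-! ### Positive operators with a given trace -/

/-- Positivity of an infinite matrix only concerns its finite sub-blocks. -/
theorem posSemidef_of_finset {X : Type} {M : Matrix X X ℂ}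
    (h : ∀ s : Finset X, (M.submatrix (fun x : s => (x : X)) fun x : s => (x : X)).PosSemidef) :
    M.PosSemidef := by
  classical
  refine ⟨?_, fun x => ?_⟩
  · ext i j
    have := (h {i, j}).1
    exact congrFun (congrFun this ⟨i, by simp⟩) ⟨j, by simp⟩
  · have h2 := (Matrix.posSemidef_iff_dotProduct_mulVec.1 (h x.support)).2 fun i => x i
    convert h2 using 1
    simp only [Finsupp.sum, dotProduct, Matrix.mulVec, Matrix.submatrix_apply, Finset.mul_sum,
      Pi.star_apply]
    rw [← Finset.sum_coe_sort x.support]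
    refine Finset.sum_congr rfl fun i _ => ?_
    rw [← Finset.sum_coe_sort x.support]
    exact Finset.sum_congr rfl fun j _ => by ring

/-- `ρ` is positive and trace class, with trace `c`. -/
def PosTrace {X : Type} (c : ℝ) (ρ : Matrix X X ℂ) : Prop :=
  ρ.PosSemidef ∧ HasSum (fun x => ρ x x) (c : ℂ)

theorem posSemidef_diag_eq_re {X : Type} {ρ : Matrix X X ℂ} (h : ρ.PosSemidef) (x : X) :
    ((ρ x x).re : ℂ) = ρ x x :=
  (Complex.eq_re_of_ofReal_le (r := 0) (by simpa using h.diag_nonneg (i := x))).symm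

theorem posSemidef_re_diag_nonneg {X : Type} {ρ : Matrix X X ℂ} (h : ρ.PosSemidef) (x : X) :
    0 ≤ (ρ x x).re :=
  (Complex.le_def.1 (h.diag_nonneg (i := x))).1

theorem IsPosTraceClass.posTrace {X : Type} {ρ : Matrix X X ℂ} (h : IsPosTraceClass ρ) :
    PosTrace (∑' x, (ρ x x).re) ρ := by
  refine ⟨h.1, ?_⟩
  have : Summable fun x => (ρ x x).re := Complex.reCLM.summable h.2
  simpa only [posSemidef_diag_eq_re h.1] using Complex.hasSum_ofReal.2 this.hasSum

theorem PosTrace.isPosTraceClass {X : Type} {c : ℝ} {ρ : Matrix X X ℂ} (h : PosTrace c ρ) :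
    IsPosTraceClass ρ := ⟨h.1, h.2.summable⟩

theorem IsDensity.posTrace {X : Type} {ρ : Matrix X X ℂ} (h : IsDensity ρ) : PosTrace 1 ρ :=
  ⟨h.1, by simpa using h.2⟩

theorem PosTrace.isDensity {X : Type} {ρ : Matrix X X ℂ} (h : PosTrace 1 ρ) : IsDensity ρ :=
  ⟨h.1, by simpa using h.2⟩

theorem PosTrace.hasSum_re {X : Type} {c : ℝ} {ρ : Matrix X X ℂ} (h : PosTrace c ρ) :
    HasSum (fun x => (ρ x x).re) c :=
  Complex.hasSum_re h.2

theorem PosTrace.diag_le {X : Type} {c : ℝ} {ρ : Matrix X X ℂ} (h : PosTrace c ρ) (x : X) :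
    (ρ x x).re ≤ c :=
  le_hasSum h.hasSum_re x fun y _ => posSemidef_re_diag_nonneg h.1 y

theorem PosTrace.add {X : Type} {c d : ℝ} {ρ σ : Matrix X X ℂ} (h : PosTrace c ρ)
    (h' : PosTrace d σ) : PosTrace (c + d) (ρ + σ) :=
  ⟨h.1.add h'.1, by simpa using h.2.add h'.2⟩

theorem PosTrace.smul {X : Type} {c r : ℝ} {ρ : Matrix X X ℂ} (h : PosTrace c ρ) (hr : 0 ≤ r) :
    PosTrace (r * c) ((r : ℂ) • ρ) :=
  ⟨h.1.smul (Complex.zero_le_real.2 hr), by simpa using h.2.mul_left (r : ℂ)⟩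

theorem PosTrace.zero {X : Type} : PosTrace 0 (0 : Matrix X X ℂ) :=
  ⟨.zero, by simp⟩

theorem PosTrace.sum {X ι : Type} (s : Finset ι) {c : ι → ℝ} {ρ : ι → Matrix X X ℂ}
    (h : ∀ i ∈ s, PosTrace (c i) (ρ i)) : PosTrace (∑ i ∈ s, c i) (∑ i ∈ s, ρ i) := by
  classical
  induction s using Finset.induction_on with
  | empty => simpa using PosTrace.zero
  | insert a s ha ih =>
    rw [Finset.sum_insert ha, Finset.sum_insert ha]
    exact (h a (by simp)).add (ih fun i hi => h i (by simp [hi]))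

theorem posTrace_ketbra {X : Type} [DecidableEq X] (x : X) : PosTrace 1 (ketbra x) := by
  constructor
  · have : ketbra x = Matrix.diagonal (Pi.single x (1 : ℂ)) := by
      ext i j
      by_cases h : i = j
      · subst h; simp [ketbra, Matrix.single_apply, Pi.single_apply, eq_comm]
      · have : ¬ (x = i ∧ x = j) := fun h' => h (h'.1.symm.trans h'.2)
        simp [ketbra, h, this]
    rw [this]
    refine Matrix.PosSemidef.diagonal fun i => ?_
    by_cases h : i = x
    · subst h; simp
    · simp [h]
  · have := hasSum_ite_eq x (1 : ℂ)
    simpa [ketbra, Matrix.single_apply, eq_comm] using this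

theorem PosTrace.kronecker {X Y : Type} {c d : ℝ} {ρ : Matrix X X ℂ} {σ : Matrix Y Y ℂ}
    (h : PosTrace c ρ) (h' : PosTrace d σ) : PosTrace (c * d) (ρ ⊗ₖ σ) := by
  classical
  constructor
  · refine posSemidef_of_finset fun s => ?_
    let f : s → s.image Prod.fst := fun p => ⟨p.1.1, Finset.mem_image_of_mem _ p.2⟩
    let g : s → s.image Prod.snd := fun p => ⟨p.1.2, Finset.mem_image_of_mem _ p.2⟩
    exact ((h.1.submatrix (fun x : s.image Prod.fst => (x : X))).kronecker
      (h'.1.submatrix (fun x : s.image Prod.snd => (x : Y)))).submatrix fun p => (f p, g p)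
  · have hs : Summable fun p : X × Y => (ρ p.1 p.1).re * (σ p.2 p.2).re :=
      h.hasSum_re.summable.mul_of_nonneg h'.hasSum_re.summable
        (posSemidef_re_diag_nonneg h.1) (posSemidef_re_diag_nonneg h'.1)
    have h2 := Complex.hasSum_ofReal.2 (h.hasSum_re.mul h'.hasSum_re hs)
    simpa only [Complex.ofReal_mul, posSemidef_diag_eq_re h.1, posSemidef_diag_eq_re h'.1,
      Matrix.kroneckerMap_apply] using h2

theorem PosTrace.compress_bijective {X Y : Type} {c : ℝ} {ρ : Matrix X X ℂ} (h : PosTrace c ρ)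
    {f : Y → X} (hf : f.Bijective) : PosTrace c (compress f ρ) :=
  ⟨h.1.submatrix f, (Equiv.ofBijective f hf).hasSum_iff.2 h.2⟩

theorem IsPosTraceClass.compress_injective {X Y : Type} {ρ : Matrix X X ℂ}
    (h : IsPosTraceClass ρ) {f : Y → X} (hf : f.Injective) : IsPosTraceClass (compress f ρ) :=
  ⟨h.1.submatrix f, h.2.comp_injective hf⟩

/-! ### Completely positive maps that rescale the trace -/

/-- `Φ` is completely positive and multiplies the trace by `c`. Such maps are closed under sums and
nonnegative multiples, unlike the case `c = 1` of CPTP maps. -/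
def CPScaling {X Y : Type} (c : ℝ) (Φ : Superop X Y) : Prop :=
  (∀ (k : ℕ) (M : Matrix (X × Fin k) (X × Fin k) ℂ), IsPosTraceClass M →
      (onLeft (Fin k) Φ M).PosSemidef) ∧
    ∀ (ρ : Matrix X X ℂ) (t : ℝ), PosTrace t ρ → HasSum (fun y => Φ ρ y y) ((c * t : ℝ) : ℂ)

theorem isCPTP_iff {X Y : Type} {Φ : Superop X Y} : IsCPTP Φ ↔ CPScaling 1 Φ := by
  refine and_congr_right fun _ => ⟨fun h ρ t hρ => by simpa using h ρ t hρ.1 hρ.2,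
    fun h ρ t hρ ht => ?_⟩
  have h1 := IsPosTraceClass.posTrace ⟨hρ, ht.summable⟩
  have h2 := h ρ _ h1
  rw [one_mul, h1.2.unique ht] at h2
  exact h2

/-- Finite ancillas suffice to test positivity in the presence of an arbitrary ancilla `W`: a finite
sub-block only involves finitely many basis states of `W`. -/
theorem CPScaling.posSemidef_onLeft {X Y : Type} {c : ℝ} {Φ : Superop X Y} (h : CPScaling c Φ)
    (W : Type) {M : Matrix (X × W) (X × W) ℂ} (hM : IsPosTraceClass M) :
    (onLeft W Φ M).PosSemidef := by
  classical
  refine posSemidef_of_finset fun s => ?_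
  let t := s.image Prod.snd
  let e := t.equivFin
  let g : s → t := fun p => ⟨p.1.2, Finset.mem_image_of_mem _ p.2⟩
  have hinj : (fun p : X × Fin t.card => (p.1, (e.symm p.2 : W))).Injective := by
    rintro ⟨a, b⟩ ⟨a', b'⟩ h
    simpa [Subtype.coe_inj] using h
  have h1 := h.1 t.card _ (hM.compress_injective hinj)
  convert h1.submatrix fun p : s => (p.1.1, e (g p)) using 1
  ext p q
  simp [onLeft_apply, compress_def, Function.comp_def, g]

/-- A map that multiplies the trace by `c` still does so in the presence of any ancilla. -/
theorem CPScaling.posTrace_onLeft {X Y : Type} {c : ℝ} {Φ : Superop X Y} (h : CPScaling c Φ)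
    {W : Type} {t : ℝ} {M : Matrix (X × W) (X × W) ℂ} (hM : PosTrace t M) :
    PosTrace (c * t) (onLeft W Φ M) := by
  have hpos := h.posSemidef_onLeft W hM.isPosTraceClass
  refine ⟨hpos, ?_⟩
  have hslice : ∀ w : W, IsPosTraceClass (compress (fun x : X => (x, w)) M) := fun w =>
    hM.isPosTraceClass.compress_injective fun a b hab => by simpa using hab
  have hsw := (Equiv.prodComm W X).hasSum_iff.2 hM.hasSum_re
  have h1 : HasSum (fun w => ∑' x, (M (x, w) (x, w)).re) t :=
    hsw.prod_fiberwise fun w => (hslice w).posTrace.hasSum_re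
  have h2 : ∀ w, HasSum (fun y => (onLeft W Φ M (y, w) (y, w)).re)
      (c * ∑' x, (M (x, w) (x, w)).re) := fun w =>
    Complex.hasSum_re (h.2 _ _ (hslice w).posTrace)
  have h3 := h1.mul_left c
  have h4 : HasSum (fun p : W × Y => (onLeft W Φ M (p.2, p.1) (p.2, p.1)).re) (c * t) := by
    have hs : Summable fun p : W × Y => (onLeft W Φ M (p.2, p.1) (p.2, p.1)).re := by
      rw [summable_prod_of_nonneg fun p => posSemidef_re_diag_nonneg hpos _]
      exact ⟨fun w => (h2 w).summable, by simpa only [(h2 _).tsum_eq] using h3.summable⟩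
    have := hs.hasSum.prod_fiberwise h2
    rw [← this.unique h3]
    exact hs.hasSum
  have h5 := (Equiv.prodComm Y W).hasSum_iff.2 h4
  have h6 := Complex.hasSum_ofReal.2 h5
  simpa only [Function.comp_def, Equiv.prodComm_apply, Prod.fst_swap, Prod.snd_swap, Prod.mk.eta,
    posSemidef_diag_eq_re hpos] using h6

theorem CPScaling.posTrace {X Y : Type} {c : ℝ} {Φ : Superop X Y} (h : CPScaling c Φ)
    {t : ℝ} {M : Matrix X X ℂ} (hM : PosTrace t M) : PosTrace (c * t) (Φ M) := by
  have hf : (fun p : X × Unit => p.1).Bijective := (Equiv.prodPUnit X).bijective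
  have := h.posTrace_onLeft (hM.compress_bijective hf)
  exact this.compress_bijective (Equiv.prodPUnit Y).symm.bijective

theorem CPScaling.onLeft {X Y : Type} {c : ℝ} {Φ : Superop X Y} (h : CPScaling c Φ) (W : Type) :
    CPScaling c (onLeft W Φ) := by
  refine ⟨fun k M hM => ?_, fun ρ t hρ => (h.posTrace_onLeft hρ).2⟩
  have h1 := h.posSemidef_onLeft (W × Fin k)
    (hM.compress_injective (Equiv.prodAssoc X W (Fin k)).symm.injective)
  exact h1.submatrix (Equiv.prodAssoc Y W (Fin k))

theorem CPScaling.comp {X Y Z : Type} {c d : ℝ} {Φ : Superop X Y} {Ψ : Superop Y Z}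
    (hΨ : CPScaling d Ψ) (hΦ : CPScaling c Φ) : CPScaling (d * c) (Ψ ∘ₗ Φ) :=
  ⟨fun k _ hM => hΨ.posSemidef_onLeft (Fin k) (hΦ.posTrace_onLeft hM.posTrace).isPosTraceClass,
    fun ρ t hρ => by rw [mul_assoc]; exact (hΨ.posTrace (hΦ.posTrace hρ)).2⟩

theorem CPScaling.compress_bijective {X Y : Type} {f : Y → X} (hf : f.Bijective) :
    CPScaling 1 (compress f) := by
  refine ⟨fun k M hM => ?_, fun ρ t hρ => ?_⟩
  · exact hM.1.submatrix fun p : Y × Fin k => (f p.1, p.2)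
  · rw [one_mul]
    exact (hρ.compress_bijective hf).2

theorem CPScaling.onRight {X Y : Type} {c : ℝ} {Φ : Superop X Y} (h : CPScaling c Φ) (W : Type) :
    CPScaling c (onRight W Φ) := by
  have := (CPScaling.compress_bijective Prod.swap_bijective).comp
    ((h.onLeft W).comp (CPScaling.compress_bijective Prod.swap_bijective))
  rwa [mul_one, one_mul] at this

theorem CPScaling.zero {X Y : Type} : CPScaling 0 (0 : Superop X Y) := by
  refine ⟨fun k M _ => ?_, fun ρ t _ => by simp⟩
  convert Matrix.PosSemidef.zero
  ext; rfl

theorem CPScaling.add {X Y : Type} {c d : ℝ} {Φ Ψ : Superop X Y} (h : CPScaling c Φ)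
    (h' : CPScaling d Ψ) : CPScaling (c + d) (Φ + Ψ) :=
  ⟨fun k M hM => (h.1 k M hM).add (h'.1 k M hM), fun ρ t hρ => by
    simpa [add_mul] using (h.2 ρ t hρ).add (h'.2 ρ t hρ)⟩

theorem CPScaling.smul {X Y : Type} {c r : ℝ} {Φ : Superop X Y} (h : CPScaling c Φ)
    (hr : 0 ≤ r) : CPScaling (r * c) ((r : ℂ) • Φ) :=
  ⟨fun k M hM => (h.1 k M hM).smul (Complex.zero_le_real.2 hr), fun ρ t hρ => by
    simpa [mul_assoc] using (h.2 ρ t hρ).mul_left (r : ℂ)⟩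

theorem CPScaling.sum {X Y ι : Type} (s : Finset ι) {c : ι → ℝ} {Φ : ι → Superop X Y}
    (h : ∀ i ∈ s, CPScaling (c i) (Φ i)) : CPScaling (∑ i ∈ s, c i) (∑ i ∈ s, Φ i) := by
  classical
  induction s using Finset.induction_on with
  | empty => simpa using CPScaling.zero
  | insert a s ha ih =>
    rw [Finset.sum_insert ha, Finset.sum_insert ha]
    exact (h a (by simp)).add (ih fun i hi => h i (by simp [hi]))

theorem CPScaling.tensorLeft {X Y : Type} {c : ℝ} {τ : Matrix Y Y ℂ} (h : PosTrace c τ) :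
    CPScaling c (tensorLeft τ : Superop X (Y × X)) := by
  refine ⟨fun k M hM => ?_, fun ρ t hρ => (h.kronecker hρ).2⟩
  have := (h.kronecker hM.posTrace).1.submatrix (Equiv.prodAssoc Y X (Fin k))
  convert this using 1
  ext p q
  simp [onLeft_apply, tensorLeft_apply]

theorem CPScaling.tensorRight {X Y : Type} {c : ℝ} {τ : Matrix Y Y ℂ} (h : PosTrace c τ) :
    CPScaling c (tensorRight τ : Superop X (X × Y)) := by
  have := (CPScaling.compress_bijective (Prod.swap_bijective (α := X) (β := Y))).comp
    (CPScaling.tensorLeft (X := X) h)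
  rw [one_mul] at this
  convert this using 1
  ext M p q
  simp [tensorRight_apply, compress_apply, tensorLeft_apply, mul_comm]

/-- A finite Kraus family `K r` with `∑ r, (K r)† K r = c`. -/
theorem CPScaling.kraus {X Y ι : Type} [Fintype X] [DecidableEq X] [Fintype ι] {c : ℝ}
    (K : ι → Matrix Y X ℂ)
    (hK : ∀ x x', HasSum (fun y => ∑ r, K r y x * star (K r y x')) (if x = x' then (c : ℂ) else 0)) :
    CPScaling c (∑ r, conj (K r)) := by
  classical
  refine ⟨fun k M hM => ?_, fun ρ t hρ => ?_⟩
  · refine posSemidef_of_finset fun s => ?_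
    have : ((BlindGraph.onLeft (Fin k) (∑ r, conj (K r)) M).submatrix (fun x : s => (x : Y × Fin k))
        fun x : s => (x : Y × Fin k)) = ∑ r,
        (Matrix.of fun (p : s) (q : X × Fin k) => if p.1.2 = q.2 then K r p.1.1 q.1 else 0) * M *
        (Matrix.of fun (p : s) (q : X × Fin k) => if p.1.2 = q.2 then K r p.1.1 q.1 else 0)ᴴ := by
      ext p q
      simp only [onLeft_apply, Matrix.submatrix_apply, LinearMap.sum_apply, Matrix.sum_apply,
        conj_apply]
      refine Finset.sum_congr rfl fun r _ => ?_
      simp only [Matrix.mul_apply, Matrix.conjTranspose_apply, Matrix.of_apply,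
        Fintype.sum_prod_type, ite_mul, zero_mul, Finset.sum_ite_eq, Finset.mem_univ, if_true,
        apply_ite star, star_zero, mul_ite, mul_zero]
    rw [this]
    exact Matrix.posSemidef_sum _ fun r _ => hM.1.mul_mul_conjTranspose_same _
  · have h1 : HasSum (fun y => ∑ x, ∑ x', ρ x x' * ∑ r, K r y x * star (K r y x'))
        (∑ x, ∑ x', ρ x x' * (if x = x' then (c : ℂ) else 0)) :=
      hasSum_sum fun x _ => hasSum_sum fun x' _ => (hK x x').mul_left _
    have h2 : ∑ x, ∑ x', ρ x x' * (if x = x' then (c : ℂ) else 0) = ((c * t : ℝ) : ℂ) := by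
      have := (hasSum_fintype fun x => ρ x x).unique hρ.2
      simp [← Finset.sum_mul, this, mul_comm]
    rw [← h2]
    convert h1 using 2 with y
    simp only [LinearMap.sum_apply, Matrix.sum_apply, conj_apply, Finset.sum_mul, Finset.mul_sum]
    rw [Finset.sum_comm]
    refine (Finset.sum_congr rfl fun x' _ => Finset.sum_comm).trans (Finset.sum_comm.trans ?_)
    exact Finset.sum_congr rfl fun x _ => Finset.sum_congr rfl fun x' _ =>
      Finset.sum_congr rfl fun r _ => by ring

/-- A device that first measures in which block of a partition of the basis the system is. -/
theorem CPScaling.blocks {X Y ι : Type} [Fintype ι] {B : ι → Type} {c : ℝ}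
    (e : (i : ι) → B i → X) (he : (fun p : Σ i, B i => e p.1 p.2).Bijective)
    {Φ : (i : ι) → Superop (B i) Y} (hΦ : ∀ i, CPScaling c (Φ i)) :
    CPScaling c (∑ i, Φ i ∘ₗ compress (e i)) := by
  have hinj : ∀ i, (e i).Injective := fun i a b hab => by
    simpa using he.1 (a₁ := ⟨i, a⟩) (a₂ := ⟨i, b⟩) hab
  refine ⟨fun k M hM => ?_, fun ρ t hρ => ?_⟩
  · have : BlindGraph.onLeft (Fin k) (∑ i, Φ i ∘ₗ compress (e i)) M = ∑ i,
        BlindGraph.onLeft (Fin k) (Φ i) (compress (Prod.map (e i) id) M) := by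
      ext p q
      simp only [onLeft_apply, LinearMap.sum_apply, Matrix.sum_apply]
      rfl
    rw [this]
    exact Matrix.posSemidef_sum _ fun i _ => (hΦ i).1 k _
      (hM.compress_injective ((hinj i).prodMap Function.injective_id))
  · have h1 : ∀ i, IsPosTraceClass (compress (e i) ρ) := fun i =>
      hρ.isPosTraceClass.compress_injective (hinj i)
    have h2 := (Equiv.ofBijective _ he).hasSum_iff.2 hρ.hasSum_re
    have h3 : HasSum (fun i => ∑' x, (compress (e i) ρ x x).re) t :=
      h2.sigma fun i => (h1 i).posTrace.hasSum_re
    have h4 := (hasSum_fintype _).unique h3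
    have h5 := hasSum_sum (s := Finset.univ) fun i _ => (hΦ i).2 _ _ (h1 i).posTrace
    rw [← Complex.ofReal_sum, ← Finset.mul_sum, h4] at h5
    simpa [Matrix.sum_apply] using h5

theorem CPScaling.discard {Y : Type} {c : ℝ} {σ : Matrix Y Y ℂ} (h : PosTrace c σ) :
    CPScaling c (measurePrepare fun _ : Unit => σ) := by
  have := (CPScaling.compress_bijective (f := fun y : Y => ((), y))
    (Equiv.punitProd Y).symm.bijective).comp (CPScaling.tensorRight (X := Unit) h)
  rw [one_mul] at this
  convert this using 1
  ext M p q
  simp [measurePrepare_apply, compress_apply, tensorRight_apply]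

theorem CPScaling.measurePrepare {X Y : Type} [Fintype X] {c : ℝ} {σ : X → Matrix Y Y ℂ}
    (h : ∀ x, PosTrace c (σ x)) : CPScaling c (measurePrepare σ) := by
  have := CPScaling.blocks (B := fun _ : X => Unit) (fun x _ => x)
    (by refine ⟨?_, fun x => ⟨⟨x, ()⟩, rfl⟩⟩; rintro ⟨a, b⟩ ⟨a', b'⟩ h; simpa using h)
    fun x => CPScaling.discard (h x)
  convert this using 1
  ext M p q
  simp [measurePrepare_apply, compress_apply, Matrix.sum_apply]

/-! ### Interactions -/

theorem isCPTP_comp {X Y Z : Type} {Φ : Superop X Y} {Ψ : Superop Y Z} (hΨ : IsCPTP Ψ)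
    (hΦ : IsCPTP Φ) : IsCPTP (Ψ ∘ₗ Φ) := by
  rw [isCPTP_iff] at *
  simpa using hΨ.comp hΦ

theorem isCPTP_onLeft {X Y : Type} (W : Type) {Φ : Superop X Y} (h : IsCPTP Φ) :
    IsCPTP (onLeft W Φ) := isCPTP_iff.2 ((isCPTP_iff.1 h).onLeft W)

theorem isCPTP_onRight {X Y : Type} (W : Type) {Φ : Superop X Y} (h : IsCPTP Φ) :
    IsCPTP (onRight W Φ) := isCPTP_iff.2 ((isCPTP_iff.1 h).onRight W)

theorem isCPTP_compress {X Y : Type} {f : Y → X} (hf : f.Bijective) : IsCPTP (compress f) :=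
  isCPTP_iff.2 (.compress_bijective hf)

theorem isCPTP_interact {l : List (Type × Type)} {A B O : Type} (S : Sender l A)
    (R : Responder l B O) (hS : S.IsPhysical) (hR : R.IsPhysical) :
    IsCPTP (interact S R).2 := by
  induction S generalizing B with
  | @done A =>
    cases R with
    | done f => exact isCPTP_onRight A hR
  | @send A A' o i l s S ih =>
    cases R with
    | @recv B B' _ _ _ _ r R =>
      have h1 : Function.Bijective fun x : (A' × i) × B' => (x.1.1, (x.2, x.1.2)) :=
        Function.bijective_iff_has_inverse.2
          ⟨fun y => ((y.1, y.2.2), y.2.1), fun _ => rfl, fun _ => rfl⟩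
      have h2 : Function.Bijective fun x : A' × (B × o) => ((x.1, x.2.2), x.2.1) :=
        Function.bijective_iff_has_inverse.2
          ⟨fun y => (y.1.1, (y.2, y.1.2)), fun _ => rfl, fun _ => rfl⟩
      rw [interact]
      exact isCPTP_comp (ih R hS.2 hR.2) (isCPTP_comp (isCPTP_compress h1)
        (isCPTP_comp (isCPTP_onRight A' hR.1) (isCPTP_comp (isCPTP_compress h2)
        (isCPTP_onLeft B hS.1))))

theorem Sender.IsPhysical.pre {l : List (Type × Type)} {A A₀ : Type} {S : Sender l A}
    (hS : S.IsPhysical) {f : Superop A₀ A} (hf : IsCPTP f) : (S.pre f).IsPhysical := by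
  cases S with
  | done => trivial
  | send s S => exact ⟨isCPTP_comp hS.1 hf, hS.2⟩

theorem Sender.pre_pre {l : List (Type × Type)} {A A₀ A₁ : Type} (S : Sender l A)
    (f : Superop A₀ A) (g : Superop A₁ A₀) : (S.pre f).pre g = S.pre (f ∘ₗ g) := by
  cases S <;> rfl

/-- The probability that the bit output by the right party of an interaction is `1`, on a joint
input `M`. -/
def prob {l : List (Type × Type)} {A B : Type} (S : Sender l A) (R : Responder l B Bool)
    (M : Matrix (A × B) (A × B) ℂ) : ℝ :=
  ∑' f, ((interact S R).2 M (f, true) (f, true)).re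

theorem probOne_eq_prob {l : List (Type × Type)} {A : Type} (D : Distinguisher l A)
    (S : Sender l A) : probOne D S = prob S D.strategy D.init := rfl

theorem prob_send_recv {l : List (Type × Type)} {A A' B B' o i : Type} (s : Superop A (A' × o))
    (S : Sender l (A' × i)) (r : Superop (B × o) (B' × i)) (R : Responder l B' Bool)
    (M : Matrix (A × B) (A × B) ℂ) :
    prob (.send s S) (.recv r R) M =
      prob S R (compress (fun x : (A' × i) × B' => (x.1.1, (x.2, x.1.2)))
        (onRight A' r (compress (fun x : A' × (B × o) => ((x.1, x.2.2), x.2.1))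
          (onLeft B s M)))) := rfl

theorem prob_pre {l : List (Type × Type)} {A A₀ B : Type} (S : Sender l A)
    (R : Responder l B Bool) (f : Superop A₀ A) (M : Matrix (A₀ × B) (A₀ × B) ℂ)
    (hl : l ≠ []) : prob (S.pre f) R M = prob S R (onLeft B f M) := by
  cases S with
  | done => exact absurd rfl hl
  | send s S => cases R; rfl

theorem prob_pre_compress {l : List (Type × Type)} {A B B₀ : Type} (S : Sender l A)
    (R : Responder l B Bool) (f : B → B₀) (M : Matrix (A × B₀) (A × B₀) ℂ) (hl : l ≠ []) :
    prob S (R.pre (compress f)) M = prob S R (compress (Prod.map id f) M) := by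
  cases S with
  | done => exact absurd rfl hl
  | send s S => cases R; rfl

/-- A probability is at most the trace of the input. This also bounds the effect of an unnormalised
part of a state. -/
theorem prob_bounds {l : List (Type × Type)} {A B : Type} {S : Sender l A}
    {R : Responder l B Bool} (hS : S.IsPhysical) (hR : R.IsPhysical) {t : ℝ}
    {M : Matrix (A × B) (A × B) ℂ} (hM : PosTrace t M) : 0 ≤ prob S R M ∧ prob S R M ≤ t := by
  have h := (isCPTP_iff.1 (isCPTP_interact S R hS hR)).posTrace hM
  rw [one_mul] at h
  have h0 := fun x => posSemidef_re_diag_nonneg h.1 x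
  refine ⟨tsum_nonneg fun f => h0 _, ?_⟩
  rw [← h.hasSum_re.tsum_eq]
  exact tsum_comp_le_tsum_of_inj h.hasSum_re.summable h0 (i := fun f => (f, true))
    fun a b hab => by simpa using hab

/-- The memory that is left on Alice's side at the end is finite. Then the sum that defines `prob` is
finite, which makes `prob` additive on arbitrary matrices, whether or not they are trace class. -/
def Sender.FiniteEnd : {l : List (Type × Type)} → {A : Type} → Sender l A → Prop
  | _, A, .done => Finite A
  | _, _, .send _ S => S.FiniteEnd

theorem Sender.FiniteEnd.pre {l : List (Type × Type)} {A A₀ : Type} {S : Sender l A}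
    (hS : S.FiniteEnd) (f : Superop A₀ A) (hl : l ≠ []) : (S.pre f).FiniteEnd := by
  cases S with
  | done => exact absurd rfl hl
  | send s S => exact hS

theorem finite_interact : {l : List (Type × Type)} → {A B O : Type} → (S : Sender l A) →
    (R : Responder l B O) → S.FiniteEnd → Finite (interact S R).1
  | _, _, _, _, .done, .done _, hS => hS
  | _, _, _, _, .send _ S, .recv _ R, hS => finite_interact S R hS

/-- The acceptance probability is the real part of a linear functional of the input. -/
theorem exists_linear_prob {l : List (Type × Type)} {A B : Type} {S : Sender l A}
    (hS : S.FiniteEnd) (R : Responder l B Bool) :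
    ∃ L : Matrix (A × B) (A × B) ℂ →ₗ[ℂ] ℂ, ∀ M, prob S R M = (L M).re := by
  have := finite_interact S R hS
  have := Fintype.ofFinite (interact S R).1
  refine ⟨∑ f, (Matrix.entryLinearMap ℂ ℂ (f, true) (f, true)) ∘ₗ (interact S R).2, fun M => ?_⟩
  simp [prob, tsum_fintype]

/-! ### Running a party next to an ancilla, and postprocessing its output -/

/-- The responder `R` with an untouched ancilla `W`, followed by `g` on its output and `W`. -/
def Responder.ext {O O' : Type} (W : Type) (g : Superop (O × W) O') :
    {l : List (Type × Type)} → {B : Type} → Responder l B O → Responder l (B × W) O'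
  | _, _, .done f => .done (g ∘ₗ onLeft W f)
  | _, _, .recv (B := B) (B' := B') (o := o) (i := i) r R =>
    .recv (compress (fun x : (B' × W) × i => ((x.1.1, x.2), x.1.2)) ∘ₗ onLeft W r ∘ₗ
      compress (fun x : (B × o) × W => ((x.1.1, x.2), x.1.2))) (R.ext W g)

/-- A measurement `g` of the output of an interaction and an ancilla can be moved into the
responder. No explicit description of the final memory `(interact S R).1` is needed. -/
theorem tsum_interact_ext {O W : Type} (g : Superop (O × W) Bool) {l : List (Type × Type)}
    {A B : Type} (S : Sender l A) (R : Responder l B O)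
    (M : Matrix ((A × B) × W) ((A × B) × W) ℂ) :
    ∑' f, (onRight (interact S R).1 g (compress (Equiv.prodAssoc _ _ _).symm
      (onLeft W (interact S R).2 M)) (f, true) (f, true)).re
      = prob S (R.ext W g) (compress (Equiv.prodAssoc _ _ _).symm M) := by
  induction S generalizing B with
  | done =>
    cases R with
    | done f => rfl
  | send s S ih =>
    cases R with
    | recv r R =>
      rw [Responder.ext, prob_send_recv]
      rw [interact]
      simp only [onLeft_comp, LinearMap.comp_apply]
      rw [ih R]
      congr 1

/-- A distinguisher for a one-shot resource applies a fixed measurement `g` to the output of the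
resource and its own memory. -/
theorem exists_probOne_oneShot {A O : Type} (D : Distinguisher [(O, Unit)] A)
    (hD : D.IsPhysical) : ∃ g : Superop (O × D.W) Bool, IsCPTP g ∧
      ∀ {F : Type} (T : Superop A (F × O)), probOne D (oneShot T) =
        ∑' f, (onRight F g (compress (Equiv.prodAssoc _ _ _).symm
          (onLeft D.W T D.init)) (f, true) (f, true)).re := by
  obtain ⟨W, init, R⟩ := D
  cases R with
  | @recv B B' O' o i _ r R =>
    cases R with
    | done f =>
      refine ⟨f ∘ₗ compress (fun b => (b, ())) ∘ₗ r ∘ₗ compress Prod.swap, ?_, ?_⟩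
      · exact isCPTP_comp hD.2.2 (isCPTP_comp
          (isCPTP_compress (Equiv.prodPUnit B').symm.bijective)
          (isCPTP_comp hD.2.1 (isCPTP_compress Prod.swap_bijective)))
      · intro F T
        rw [← (Equiv.prodPUnit F).tsum_eq]
        rfl

/-! ### Phases and rotations -/

/-- The diagonal of `R_Z(θ)` up to a global phase: `1` on `|0⟩` and `e^{iθ}` on `|1⟩`. -/
def phase (φ : ZMod 8) (b : Bool) : ℂ := if b then Complex.exp (Complex.I * angle φ) else 1

theorem inv_sqrt_two_mul_self : (Real.sqrt 2 : ℂ)⁻¹ * (Real.sqrt 2 : ℂ)⁻¹ = 1 / 2 := by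
  rw [← mul_inv, ← Complex.ofReal_mul, Real.mul_self_sqrt (by norm_num)]
  norm_num

theorem exp_angle (φ : ZMod 8) :
    Complex.exp (Complex.I * angle φ) = Complex.exp (Complex.I * (Real.pi / 4)) ^ φ.val := by
  rw [← Complex.exp_nat_mul]
  congr 1
  simp only [angle]
  push_cast
  ring

theorem exp_angle_add (φ ψ : ZMod 8) : Complex.exp (Complex.I * angle (φ + ψ)) =
    Complex.exp (Complex.I * angle φ) * Complex.exp (Complex.I * angle ψ) := by
  have h8 : Complex.exp (Complex.I * (Real.pi / 4)) ^ 8 = 1 := by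
    rw [← Complex.exp_nat_mul, ← Complex.exp_two_pi_mul_I]
    congr 1
    push_cast
    ring
  rw [exp_angle, exp_angle, exp_angle, ← pow_add, ZMod.val_add, ← pow_eq_pow_mod _ h8]

theorem phase_add (φ ψ : ZMod 8) (b : Bool) : phase (φ + ψ) b = phase φ b * phase ψ b := by
  cases b <;> simp [phase, exp_angle_add]

theorem phase_zero (b : Bool) : phase 0 b = 1 := by
  cases b <;> simp [phase, angle]

theorem phase_mul_star (φ : ZMod 8) (b : Bool) : phase φ b * star (phase φ b) = 1 := by
  cases b
  · simp [phase]
  · simp [phase, ← Complex.exp_conj, ← Complex.exp_add]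

/-- The global phase of `R_Z` cancels in conjugations. -/
theorem rotZ_mul_star (φ : ZMod 8) (b b' : Bool) :
    rotZ (angle φ) b b * star (rotZ (angle φ) b' b') = phase φ b * star (phase φ b') := by
  have h : ∀ c, rotZ (angle φ) c c = Complex.exp (-Complex.I * (angle φ / 2)) * phase φ c := by
    intro c
    cases c
    · simp [rotZ, phase]
    · simp only [rotZ, phase, Matrix.diagonal_apply_eq, if_true]
      rw [← Complex.exp_add]
      congr 1
      ring
  have h1 : Complex.exp (-Complex.I * (angle φ / 2)) *
      star (Complex.exp (-Complex.I * (angle φ / 2))) = 1 := by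
    simp [← Complex.exp_conj, ← Complex.exp_add, Complex.conj_ofNat]
  rw [h, h, star_mul']
  linear_combination (phase φ b * star (phase φ b')) * h1

theorem conj_diagonal_apply {X : Type} [Fintype X] [DecidableEq X] (d : X → ℂ)
    (M : Matrix X X ℂ) (x y : X) : conj (Matrix.diagonal d) M x y = d x * M x y * star (d y) := by
  simp [conj_apply, Matrix.diagonal_apply, apply_ite]

theorem conj_rotZ_apply (φ : ZMod 8) (M : Matrix Bool Bool ℂ) (b b' : Bool) :
    conj (rotZ (angle φ)) M b b' = phase φ b * star (phase φ b') * M b b' := by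
  have h := rotZ_mul_star φ b b'
  simp only [rotZ, Matrix.diagonal_apply_eq] at h
  rw [rotZ, conj_diagonal_apply, ← h]
  ring

theorem cpScaling_conj {X Y : Type} [Fintype X] [DecidableEq X] {c : ℝ} (K : Matrix Y X ℂ)
    (hK : ∀ x x', HasSum (fun y => K y x * star (K y x')) (if x = x' then (c : ℂ) else 0)) :
    CPScaling c (conj K) := by
  simpa using CPScaling.kraus (ι := Unit) (fun _ => K) (by simpa using hK)

theorem cpScaling_conj_rotZ (φ : ZMod 8) : CPScaling 1 (conj (rotZ (angle φ))) := by
  refine cpScaling_conj _ fun x x' => ?_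
  rcases eq_or_ne x x' with rfl | h
  · have := (rotZ_mul_star φ x x).trans (phase_mul_star φ x)
    rw [if_pos rfl, Complex.ofReal_one, ← this]
    exact hasSum_single x fun y hy => by simp [rotZ, hy]
  · rw [if_neg h]
    convert hasSum_zero using 2 with y
    rcases eq_or_ne y x with rfl | hy
    · simp [rotZ, h]
    · simp [rotZ, hy]

/-- The projector onto `|+_φ⟩ = (|0⟩ + e^{iφ} |1⟩) / √2`. -/
def plus (φ : ZMod 8) : Matrix Bool Bool ℂ := fun b b' => phase φ b * star (phase φ b') / 2

theorem conj_rotZ_plus (φ ψ : ZMod 8) : conj (rotZ (angle φ)) (plus ψ) = plus (ψ + φ) := by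
  ext b b'
  rw [conj_rotZ_apply, plus, plus, phase_add, phase_add, star_mul']
  ring

theorem posTrace_plus (φ : ZMod 8) : PosTrace 1 (plus φ) := by
  constructor
  · have : plus φ = (1 / 2 : ℝ) • Matrix.vecMulVec (phase φ) (star (phase φ)) := by
      ext b b'
      simp [plus, Matrix.vecMulVec_apply]
      ring
    rw [this]
    exact (Matrix.posSemidef_vecMulVec_self_star _).smul (by norm_num)
  · have h : ∀ b, plus φ b b = 1 / 2 := fun b => by rw [plus, phase_mul_star]
    simp only [h]
    have h2 := hasSum_fintype fun _ : Bool => (1 / 2 : ℂ)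
    rw [Fintype.sum_bool, add_halves] at h2
    simpa using h2

/-! ### Mixtures of photon number states -/

/-- The binomial expansion of `(a_θ†)^k |vac⟩` in the photon number basis. -/
theorem iterate_creation_vacuum (k : ℕ) (θ : ℝ) (p : Fock) : (creation θ)^[k] vacuum p =
    if p.1 + p.2 = k then (k.factorial : ℂ) / (Real.sqrt p.1.factorial * Real.sqrt p.2.factorial)
      * Complex.exp (Complex.I * θ) ^ p.2 / (Real.sqrt 2 : ℂ) ^ k else 0 := by
  induction k generalizing p with
  | zero =>
    obtain ⟨a, b⟩ := p
    by_cases h : a + b = 0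
    · obtain ⟨rfl, rfl⟩ : a = 0 ∧ b = 0 := by omega
      simp [vacuum]
    · have : ¬ (a = 0 ∧ b = 0) := by omega
      simp [vacuum, this]
  | succ k ih =>
    obtain ⟨a, b⟩ := p
    rw [Function.iterate_succ_apply', creation, ih, ih]
    have h2 : (Real.sqrt 2 : ℂ) ≠ 0 := by simp
    have hs : ∀ m : ℕ, (Real.sqrt (m.factorial : ℝ) : ℂ) ≠ 0 := fun m => by
      simp [Nat.factorial_ne_zero]
    -- the two terms vanish unless the mode in question is occupied
    have hL : (Real.sqrt a : ℂ) * (if a - 1 + b = k then (k.factorial : ℂ) /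
        (Real.sqrt (a - 1).factorial * Real.sqrt b.factorial) * Complex.exp (Complex.I * θ) ^ b /
        (Real.sqrt 2 : ℂ) ^ k else 0) = if a + b = k + 1 then (k.factorial : ℂ) * a /
        (Real.sqrt a.factorial * Real.sqrt b.factorial) * Complex.exp (Complex.I * θ) ^ b /
        (Real.sqrt 2 : ℂ) ^ k else 0 := by
      cases a with
      | zero => simp
      | succ a =>
        have e : (Real.sqrt (a + 1).factorial : ℂ) =
            (Real.sqrt ((a + 1 : ℕ) : ℝ) : ℂ) * Real.sqrt a.factorial := by
          rw [Nat.factorial_succ, Nat.cast_mul, Real.sqrt_mul (by positivity), Complex.ofReal_mul]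
        have hn : (Real.sqrt ((a + 1 : ℕ) : ℝ) : ℂ) ≠ 0 := by
          rw [Complex.ofReal_ne_zero]; positivity
        have hsq : (Real.sqrt ((a + 1 : ℕ) : ℝ) : ℂ) * Real.sqrt ((a + 1 : ℕ) : ℝ) =
            ((a + 1 : ℕ) : ℂ) := by
          rw [← Complex.ofReal_mul, Real.mul_self_sqrt (by positivity)]; simp
        have hc : (a + 1 - 1 + b = k) = (a + 1 + b = k + 1) := by
          apply propext; omega
        simp only [hc]
        split_ifs
        · rw [e, ← hsq]
          have := hs a
          have := hs b
          simp only [Nat.add_sub_cancel]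
          field_simp
        · simp
    have hR : (Real.sqrt b : ℂ) * (if a + (b - 1) = k then (k.factorial : ℂ) /
        (Real.sqrt a.factorial * Real.sqrt (b - 1).factorial) *
        Complex.exp (Complex.I * θ) ^ (b - 1) /
        (Real.sqrt 2 : ℂ) ^ k else 0) * Complex.exp (Complex.I * θ) =
        if a + b = k + 1 then (k.factorial : ℂ) * b /
        (Real.sqrt a.factorial * Real.sqrt b.factorial) * Complex.exp (Complex.I * θ) ^ b /
        (Real.sqrt 2 : ℂ) ^ k else 0 := by
      cases b with
      | zero => simp
      | succ b =>
        have e : (Real.sqrt (b + 1).factorial : ℂ) =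
            (Real.sqrt ((b + 1 : ℕ) : ℝ) : ℂ) * Real.sqrt b.factorial := by
          rw [Nat.factorial_succ, Nat.cast_mul, Real.sqrt_mul (by positivity), Complex.ofReal_mul]
        have hn : (Real.sqrt ((b + 1 : ℕ) : ℝ) : ℂ) ≠ 0 := by
          rw [Complex.ofReal_ne_zero]; positivity
        have hsq : (Real.sqrt ((b + 1 : ℕ) : ℝ) : ℂ) * Real.sqrt ((b + 1 : ℕ) : ℝ) =
            ((b + 1 : ℕ) : ℂ) := by
          rw [← Complex.ofReal_mul, Real.mul_self_sqrt (by positivity)]; simp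
        have hc : (a + (b + 1 - 1) = k) = (a + (b + 1) = k + 1) := by
          apply propext; omega
        simp only [hc]
        split_ifs
        · rw [e, ← hsq]
          have := hs a
          have := hs b
          simp only [Nat.add_sub_cancel]
          rw [pow_succ (Complex.exp _) b]
          field_simp
        · simp
    dsimp only at hL hR ⊢
    rw [mul_comm (Complex.exp _), hL, hR]
    split_ifs with h
    · have : (a : ℂ) + b = k + 1 := by exact_mod_cast h
      rw [Nat.factorial_succ]
      push_cast
      rw [← this]
      have := hs a
      have := hs b
      rw [pow_succ (Real.sqrt 2 : ℂ) k]
      field_simp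
    · simp

theorem photons_of_ne {k : ℕ} {θ : ℝ} {p : Fock} (h : p.1 + p.2 ≠ k) : photons k θ p = 0 := by
  rw [photons, iterate_creation_vacuum, if_neg h, zero_div]

theorem normSq_photons (k : ℕ) (θ : ℝ) (p : Fock) (h : p.1 + p.2 = k) :
    photons k θ p * star (photons k θ p) = (((k.choose p.1 : ℝ) / 2 ^ k : ℝ) : ℂ) := by
  rw [photons, iterate_creation_vacuum, if_pos h]
  have hc : (k.choose p.1 : ℝ) = k.factorial / (p.1.factorial * p.2.factorial) := by
    rw [Nat.choose_eq_factorial_div_factorial (by omega),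
      Nat.cast_div (Nat.factorial_mul_factorial_dvd_factorial (by omega))
        (by positivity)]
    rw [show k - p.1 = p.2 by omega]
    push_cast
    rfl
  have he : ‖Complex.exp (Complex.I * θ)‖ = 1 := by
    rw [mul_comm]; exact Complex.norm_exp_ofReal_mul_I θ
  rw [show ∀ z : ℂ, z * star z = ((‖z‖ ^ 2 : ℝ) : ℂ) from fun z => by
    simpa using Complex.mul_conj' z, hc]
  congr 1
  simp only [norm_div, norm_mul, norm_pow, he, Complex.norm_real, Complex.norm_natCast,
    Real.norm_eq_abs, abs_of_nonneg (Real.sqrt_nonneg _), div_pow, mul_pow,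
    Real.sq_sqrt (Nat.cast_nonneg _), one_pow]
  rw [← pow_mul, mul_comm k 2, pow_mul, Real.sq_sqrt (by norm_num)]
  have := Nat.factorial_ne_zero k
  field_simp

/-- The mixture of the states `|k⟩_θ` with weights `w k`. -/
def fockMix (w : ℕ → ℝ) (θ : ℝ) : Matrix Fock Fock ℂ := fun p q =>
  ∑' k : ℕ, (w k : ℂ) * (photons k θ p * star (photons k θ q))

/-- The sum over the photon number reduces to one term, because `|k⟩_θ` only has amplitudes on the
basis states with `k` photons. -/
theorem fockMix_apply (w : ℕ → ℝ) (θ : ℝ) (p q : Fock) : fockMix w θ p q =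
    (w (p.1 + p.2) : ℂ) * (photons (p.1 + p.2) θ p * star (photons (p.1 + p.2) θ q)) :=
  tsum_eq_single _ fun k hk => by rw [photons_of_ne hk.symm]; simp

theorem fockMix_add (w v : ℕ → ℝ) (θ : ℝ) :
    fockMix (fun k => w k + v k) θ = fockMix w θ + fockMix v θ := by
  ext p q
  simp only [fockMix_apply, Matrix.add_apply]
  push_cast
  ring

theorem posTrace_fockMix {w : ℕ → ℝ} (hw : ∀ k, 0 ≤ w k) {c : ℝ} (hc : HasSum w c) (θ : ℝ) :
    PosTrace c (fockMix w θ) := by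
  constructor
  · refine posSemidef_of_finset fun s => ?_
    have : ((fockMix w θ).submatrix (fun x : s => (x : Fock)) fun x : s => (x : Fock)) =
        ∑ k ∈ s.image (fun p => p.1 + p.2), (w k : ℂ) • Matrix.vecMulVec
          (fun x : s => photons k θ x) (star fun x : s => photons k θ x) := by
      ext p q
      rw [Matrix.submatrix_apply, fockMix_apply, Matrix.sum_apply,
        Finset.sum_eq_single_of_mem (p.1.1 + p.1.2)
          (Finset.mem_image_of_mem (fun p : Fock => p.1 + p.2) p.2) fun k _ hk => by
            simp [Matrix.vecMulVec_apply, photons_of_ne hk.symm]]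
      simp [Matrix.vecMulVec_apply]
    rw [this]
    exact Matrix.posSemidef_sum _ fun k _ =>
      (Matrix.posSemidef_vecMulVec_self_star _).smul (Complex.zero_le_real.2 (hw k))
  · have hd : ∀ p : Fock, fockMix w θ p p =
        ((w (p.1 + p.2) * (((p.1 + p.2).choose p.1 : ℝ) / 2 ^ (p.1 + p.2)) : ℝ) : ℂ) := fun p => by
      rw [fockMix_apply, normSq_photons _ _ _ rfl, Complex.ofReal_mul]
    simp only [hd]
    refine Complex.hasSum_ofReal.2 ?_
    set f : Fock → ℝ := fun p => w (p.1 + p.2) * (((p.1 + p.2).choose p.1 : ℝ) / 2 ^ (p.1 + p.2))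
    rw [← (Finset.HasAntidiagonal.sigmaAntidiagonalEquivProd (A := ℕ)).hasSum_iff]
    have hf : ∀ n, HasSum (fun p : (Finset.HasAntidiagonal.antidiagonal n : Finset (ℕ × ℕ)) =>
        (f ∘ Finset.HasAntidiagonal.sigmaAntidiagonalEquivProd) ⟨n, p⟩) (w n) := fun n => by
      convert hasSum_fintype _
      refine Eq.trans ?_
        (Finset.sum_coe_sort (Finset.HasAntidiagonal.antidiagonal n) fun p => f p).symm
      rw [Finset.sum_congr rfl (g := fun p => w n / 2 ^ n * (n.choose p.1 : ℝ))]
      · rw [← Finset.mul_sum, Finset.Nat.sum_antidiagonal_eq_sum_range_succ_mk]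
        have := Nat.sum_range_choose n
        rw [← Nat.cast_sum, this]
        push_cast
        field_simp
      · intro p hp
        rw [Finset.HasAntidiagonal.mem_antidiagonal] at hp
        simp only [f, hp]
        ring
    have hnn : ∀ x, 0 ≤ (f ∘ Finset.HasAntidiagonal.sigmaAntidiagonalEquivProd) x := fun x =>
      mul_nonneg (hw _) (by positivity)
    have hs := (summable_sigma_of_nonneg hnn).2
      ⟨fun n => (hf n).summable, by simpa only [(hf _).tsum_eq] using hc.summable⟩
    rw [← (hs.hasSum.sigma hf).unique hc]
    exact hs.hasSum

/-! ### Splitting a pulse by its photon number -/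

/-- The probability of `k` photons in a pulse. -/
def poisson (α : ℂ) (k : ℕ) : ℝ := Real.exp (-‖α‖ ^ 2) * ‖α‖ ^ (2 * k) / k.factorial

theorem poisson_nonneg (α : ℂ) (k : ℕ) : 0 ≤ poisson α k := by
  unfold poisson; positivity

theorem hasSum_poisson (α : ℂ) : HasSum (poisson α) 1 := by
  have h := (NormedSpace.expSeries_div_hasSum_exp (𝔸 := ℝ) (‖α‖ ^ 2)).mul_left
    (Real.exp (-‖α‖ ^ 2))
  rw [← Real.exp_eq_exp_ℝ, ← Real.exp_add, neg_add_cancel, Real.exp_zero] at h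
  refine h.congr_fun fun k => ?_
  rw [poisson, pow_mul, mul_div_assoc]

/-- The part of a pulse with at least two photons. -/
def multiPart (α : ℂ) (θ : ℝ) : Matrix Fock Fock ℂ :=
  fockMix (fun k => if k < 2 then 0 else poisson α k) θ

/-- The part of a pulse with at most one photon. -/
def singlePart (α : ℂ) (θ : ℝ) : Matrix Fock Fock ℂ :=
  fockMix (fun k => if k < 2 then poisson α k else 0) θ

theorem pulse_eq (α : ℂ) (θ : ℝ) : pulse α θ = singlePart α θ + multiPart α θ := by
  rw [singlePart, multiPart, ← fockMix_add]
  change fockMix (poisson α) θ = _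
  congr 1
  ext k
  split_ifs <;> simp

theorem posTrace_pulse (α : ℂ) (θ : ℝ) : PosTrace 1 (pulse α θ) :=
  posTrace_fockMix (poisson_nonneg α) (hasSum_poisson α) θ

theorem posTrace_multiPart (α : ℂ) (θ : ℝ) : PosTrace (probMulti α) (multiPart α θ) := by
  refine posTrace_fockMix (fun k => by split_ifs <;> simp [poisson_nonneg]) ?_ θ
  have h1 : HasSum (fun k => if k < 2 then poisson α k else 0) (poisson α 0 + poisson α 1) := by
    have := hasSum_sum_of_ne_finset_zero (s := Finset.range 2)
      (f := fun k => if k < 2 then poisson α k else 0)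
      (L := SummationFilter.unconditional ℕ) fun k hk => if_neg (by simpa using hk)
    simpa [Finset.sum_range_succ] using this
  have h2 := (hasSum_poisson α).sub h1
  have h3 : 1 - (poisson α 0 + poisson α 1) = probMulti α := by
    simp [probMulti, poisson]
    ring
  rw [h3] at h2
  refine h2.congr_fun fun k => ?_
  split_ifs <;> simp

/-- The basis state of a single photon with the given polarisation. -/
def onePhoton (b : Bool) : Fock := if b then (0, 1) else (1, 0)

/-- The isometry that encodes a qubit in the polarisation of one photon. -/
def polarisation : Matrix Fock Bool ℂ := Matrix.of fun p b => if p = onePhoton b then 1 else 0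

/-- Encodes a qubit in a pulse with at most one photon, as far as the photon number allows: with
the weight of the vacuum the qubit is discarded. -/
def encode (α : ℂ) : Superop Bool Fock :=
  ((poisson α 0 : ℝ) : ℂ) • measurePrepare (fun _ => ketbra (0, 0))
    + ((poisson α 1 : ℝ) : ℂ) • conj polarisation

theorem cpScaling_encode (α : ℂ) : CPScaling (1 - probMulti α) (encode α) := by
  have h1 : CPScaling 1 (conj polarisation) := by
    refine cpScaling_conj _ fun x x' => ?_
    have h : polarisation (onePhoton x) x * star (polarisation (onePhoton x) x') =
        if x = x' then ((1 : ℝ) : ℂ) else 0 := by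
      cases x <;> cases x' <;> simp [polarisation, onePhoton]
    rw [← h]
    exact hasSum_single _ fun p hp => by simp [polarisation, hp]
  have h0 : CPScaling 1 (measurePrepare (fun _ : Bool => ketbra ((0, 0) : Fock))) :=
    CPScaling.measurePrepare fun _ => posTrace_ketbra _
  have h2 := (h0.smul (poisson_nonneg α 0)).add (h1.smul (poisson_nonneg α 1))
  have h3 : poisson α 0 * 1 + poisson α 1 * 1 = 1 - probMulti α := by
    simp [probMulti, poisson]
    ring
  rwa [h3] at h2

/-- The states `|0⟩_θ` and `|1⟩_θ` depend on the angle only through the qubit `|+_θ⟩`: a pulse with at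
most one photon can be made from this qubit. -/
theorem encode_plus (α : ℂ) (φ : ZMod 8) : encode α (plus φ) = singlePart α (angle φ) := by
  have h2 : (Real.sqrt 2 : ℂ) * Real.sqrt 2 = 2 := by
    rw [← Complex.ofReal_mul, Real.mul_self_sqrt (by norm_num)]; simp
  have h0 : photons 0 (angle φ) = fun p => if p = (0, 0) then 1 else 0 := by
    ext p
    simp [photons, vacuum]
  have h1 : photons 1 (angle φ) =
      fun p => ∑ b, if p = onePhoton b then phase φ b / Real.sqrt 2 else 0 := by
    ext ⟨a, b⟩
    rw [photons, iterate_creation_vacuum, Fintype.sum_bool]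
    by_cases h : a + b = 1
    · rcases (show (a = 0 ∧ b = 1) ∨ (a = 1 ∧ b = 0) by omega) with ⟨rfl, rfl⟩ | ⟨rfl, rfl⟩ <;>
        simp [onePhoton, phase]
    · have h3 : ¬ (a = 0 ∧ b = 1) := by omega
      have h4 : ¬ (a = 1 ∧ b = 0) := by omega
      simp [onePhoton, h, h3, h4]
  ext p q
  have hR : singlePart α (angle φ) p q = ∑ k ∈ Finset.range 2, (poisson α k : ℂ) *
      (photons k (angle φ) p * star (photons k (angle φ) q)) := by
    refine (tsum_eq_sum (s := Finset.range 2) fun k hk => ?_).trans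
      (Finset.sum_congr rfl fun k hk => ?_)
    · have : ¬ k < 2 := by simpa using hk
      simp [this]
    · have : k < 2 := by simpa using hk
      simp [this]
  rw [hR, Finset.sum_range_succ, Finset.sum_range_one, h0, h1, encode, LinearMap.add_apply,
    LinearMap.smul_apply, LinearMap.smul_apply, Matrix.add_apply, Matrix.smul_apply,
    Matrix.smul_apply, smul_eq_mul, smul_eq_mul, measurePrepare_apply, conj_apply,
    Matrix.sum_apply]
  have e0 : ∑ b, (plus φ b b • ketbra ((0, 0) : Fock)) p q =
      (if p = (0, 0) then 1 else 0) * star (if q = (0, 0) then (1 : ℂ) else 0) := by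
    have h : ∀ b, plus φ b b = 1 / 2 := fun b => by rw [plus, phase_mul_star]
    simp only [h, Fintype.sum_bool, ← Matrix.add_apply, ← add_smul, add_halves, one_smul]
    by_cases hp : p = (0, 0) <;> by_cases hq : q = (0, 0) <;>
      simp [ketbra, hp, hq, eq_comm]
  have e1 : ∑ x', (∑ x, polarisation p x * plus φ x x') * star (polarisation q x') =
      (∑ b, if p = onePhoton b then phase φ b / (Real.sqrt 2 : ℂ) else 0) *
        star (∑ b, if q = onePhoton b then phase φ b / (Real.sqrt 2 : ℂ) else 0) := by
    rw [star_sum, Finset.sum_mul_sum, Finset.sum_comm]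
    refine Finset.sum_congr rfl fun x' _ => ?_
    rw [Finset.sum_mul]
    refine Finset.sum_congr rfl fun x _ => ?_
    simp only [polarisation, Matrix.of_apply, plus]
    split_ifs
    · rw [star_one, star_div₀, show star (Real.sqrt 2 : ℂ) = Real.sqrt 2 from Complex.conj_ofReal _,
        one_mul, mul_one, div_mul_div_comm, h2]
    all_goals simp
  rw [e0, e1]

/-! ### Product states sent one mode at a time -/

theorem onLeft_kronecker {X Y W : Type} (Φ : Superop X Y) (M : Matrix X X ℂ) (N : Matrix W W ℂ) :
    onLeft W Φ (M ⊗ₖ N) = Φ M ⊗ₖ N := by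
  ext p q
  have : (M ⊗ₖ N).submatrix (·, p.2) (·, q.2) = N p.2 q.2 • M := by
    ext x x'
    simp [mul_comm]
  rw [onLeft_apply, this, map_smul, Matrix.smul_apply, smul_eq_mul, mul_comm]
  rfl

theorem onRight_kronecker {X Y W : Type} (Φ : Superop X Y) (M : Matrix X X ℂ)
    (N : Matrix W W ℂ) : onRight W Φ (N ⊗ₖ M) = N ⊗ₖ Φ M := by
  ext p q
  have : (N ⊗ₖ M).submatrix (p.1, ·) (q.1, ·) = N p.1 q.1 • M := by
    ext x x'
    simp
  rw [onRight_apply, this, map_smul, Matrix.smul_apply, smul_eq_mul]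
  rfl

theorem measurePrepare_ketbra {X Y : Type} [Fintype X] [DecidableEq X] (σ : X → Matrix Y Y ℂ)
    (x : X) : measurePrepare σ (ketbra x) = σ x := by
  rw [measurePrepare_apply, Finset.sum_eq_single x]
  · simp [ketbra]
  · intro y _ hy
    simp [ketbra, hy.symm]
  · simp

theorem onLeft_measurePrepare {X Y W : Type} [Fintype X] (σ : X → Matrix Y Y ℂ)
    (M : Matrix (X × W) (X × W) ℂ) :
    onLeft W (measurePrepare σ) M = ∑ x, σ x ⊗ₖ compress (fun w => (x, w)) M := by
  ext p q
  simp [onLeft_apply, measurePrepare_apply, Matrix.sum_apply, compress_apply, mul_comm]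

theorem rounds_ne_nil (n : ℕ) : rounds n ≠ [] := by
  cases n <;> simp [rounds]

/-- Sending a part `τ` that is in a product state with the memory and with the receiver. -/
theorem prob_send_product {l : List (Type × Type)} {A A' B B' o i : Type}
    {s : Superop A (A' × o)} {S : Sender l (A' × i)} {r : Superop (B × o) (B' × i)}
    {R : Responder l B' Bool} {M : Matrix (A × B) (A × B) ℂ} {X : Matrix A' A' ℂ}
    {τ : Matrix o o ℂ} {ρ : Matrix B B ℂ} (hM : onLeft B s M = (X ⊗ₖ τ) ⊗ₖ ρ) :
    prob (.send s S) (.recv r R) M =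
      prob S R (compress (fun x : (A' × i) × B' => (x.1.1, (x.2, x.1.2)))
        (X ⊗ₖ r (ρ ⊗ₖ τ))) := by
  rw [prob_send_recv, hM, ← onRight_kronecker]
  congr 3
  ext p q
  simp only [compress_apply, Matrix.kroneckerMap_apply]
  ring

/-- The product of the operators `τ i`. -/
def prodState {n : ℕ} (τ : Fin n → Matrix Fock Fock ℂ) :
    Matrix (Fin n → Fock) (Fin n → Fock) ℂ := fun f g => ∏ i, τ i (f i) (g i)

/-- Splits off the first of several modes. -/
def splitHead {X : Type} (n : ℕ) : (Fin (n + 1) → X) → X × (Fin n → X) := fun f => (f 0, Fin.tail f)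

theorem splitHead_bijective {X : Type} (n : ℕ) : (splitHead n (X := X)).Bijective :=
  Function.bijective_iff_has_inverse.2
    ⟨fun p => Fin.cons p.1 p.2, fun f => by simp [splitHead], fun p => by simp [splitHead]⟩

theorem prodState_succ {n : ℕ} (τ : Fin (n + 1) → Matrix Fock Fock ℂ) :
    prodState τ = compress (splitHead n) (τ 0 ⊗ₖ prodState (Fin.tail τ)) := by
  ext f g
  simp [prodState, compress_apply, splitHead, Fin.prod_univ_succ, Fin.tail]

theorem prodState_zero (τ : Fin 0 → Matrix Fock Fock ℂ) : prodState τ = ketbra default := by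
  ext f g
  simp [prodState, ketbra, Subsingleton.elim f default, Subsingleton.elim g default]

theorem posTrace_prodState {n : ℕ} {c : ℝ} {τ : Fin n → Matrix Fock Fock ℂ}
    (h : ∀ i, PosTrace c (τ i)) : PosTrace (c ^ n) (prodState τ) := by
  induction n with
  | zero => rw [pow_zero, prodState_zero]; exact posTrace_ketbra _
  | succ n ih =>
    rw [prodState_succ, pow_succ']
    exact ((h 0).kronecker (ih fun i => h i.succ)).compress_bijective (splitHead_bijective n)

/-- Sends the modes of a joint state in its memory one after the other, then the bit. -/
def sendAll : (n : ℕ) → Sender (rounds n) ((Fin n → Fock) × Bool)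
  | 0 => .send (A' := Unit) (compress fun p => (default, p.2)) .done
  | n + 1 => .send (compress fun p : ((Fin n → Fock) × Bool) × Fock => (Fin.cons p.2 p.1.1, p.1.2))
      ((sendAll n).pre (compress fun y => (y, ())))

theorem sendAll_isPhysical (n : ℕ) : (sendAll n).IsPhysical := by
  induction n with
  | zero =>
    refine ⟨isCPTP_compress (Function.bijective_iff_has_inverse.2
      ⟨fun p => ((), p.2), fun p => rfl, fun p => ?_⟩), trivial⟩
    exact Prod.ext (Subsingleton.elim _ _) rfl
  | succ n ih =>
    refine ⟨isCPTP_compress (Function.bijective_iff_has_inverse.2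
      ⟨fun p => ((Fin.tail p.1, p.2), p.1 0), fun p => by simp, fun p => by simp⟩), ?_⟩
    exact ih.pre (isCPTP_compress (Equiv.prodPUnit _).symm.bijective)

theorem sendAll_finiteEnd (n : ℕ) : (sendAll n).FiniteEnd := by
  induction n with
  | zero => exact inferInstanceAs (Finite (Unit × Bool))
  | succ n ih => exact ih.pre _ (rounds_ne_nil n)

theorem aliceSend_finiteEnd (α : ℂ) (n : ℕ) : (aliceSend α n).FiniteEnd := by
  induction n with
  | zero => exact inferInstanceAs (Finite (Unit × Bool))
  | succ n ih => exact ih.pre _ (rounds_ne_nil n)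

theorem ketbra_prod {X Y : Type} [DecidableEq X] [DecidableEq Y] (x : X) (y : Y) :
    ketbra (x, y) = ketbra x ⊗ₖ ketbra y := by
  rw [ketbra, ketbra, ketbra, Matrix.single_kronecker_single, one_mul]

/-- One round of the sender: once a pulse `τ` is sent, Alice goes on with the rest. -/
theorem prob_send_mode {l : List (Type × Type)} {A A' B B' : Type} {s : Superop A (A' × Fock)}
    {S : Sender l A'} {r : Superop (B × Fock) (B' × Unit)} {R : Responder l B' Bool}
    (hl : l ≠ []) {M : Matrix (A × B) (A × B) ℂ} {X : Matrix A' A' ℂ} {τ : Matrix Fock Fock ℂ}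
    {ρ : Matrix B B ℂ} (hM : onLeft B s M = (X ⊗ₖ τ) ⊗ₖ ρ) :
    prob (.send s (S.pre (compress fun y => (y, ())))) (.recv r R) M =
      prob S R (X ⊗ₖ compress (fun b => (b, ())) (r (ρ ⊗ₖ τ))) := by
  rw [prob_send_product hM, prob_pre _ _ _ _ hl]
  rfl

theorem onLeft_aliceSend_step (α : ℂ) {n : ℕ} {B : Type} (x : Fin (n + 1) → ZMod 8) (m : Bool)
    (ρ : Matrix B B ℂ) :
    onLeft B (measurePrepare fun x : (Fin (n + 1) → ZMod 8) × Bool =>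
      ketbra (Fin.tail x.1, x.2) ⊗ₖ pulse α (angle (x.1 0))) (ketbra (x, m) ⊗ₖ ρ) =
    (ketbra (Fin.tail x, m) ⊗ₖ pulse α (angle (x 0))) ⊗ₖ ρ := by
  rw [onLeft_kronecker, measurePrepare_ketbra]

/-- Alice's pulses may as well be prepared all together before the first one is sent. -/
theorem prob_aliceSend (α : ℂ) (n : ℕ) {B : Type} (R : Responder (rounds n) B Bool)
    (x : Fin n → ZMod 8) (m : Bool) (ρ : Matrix B B ℂ) :
    prob (aliceSend α n) R (ketbra (x, m) ⊗ₖ ρ) =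
      prob (sendAll n) R ((prodState (fun i => pulse α (angle (x i))) ⊗ₖ ketbra m) ⊗ₖ ρ) := by
  induction n generalizing B with
  | zero =>
    cases R with
    | recv r R =>
      refine (prob_send_product (l := []) (X := ketbra ()) (τ := ketbra m) (ρ := ρ) ?_).trans
        (prob_send_product (l := []) (X := ketbra ()) (τ := ketbra m) (ρ := ρ) ?_).symm
      · rw [onLeft_kronecker, measurePrepare_ketbra, ketbra_prod]
      · rw [prodState_zero, onLeft_kronecker]
        congr 1
  | succ n ih =>
    cases R with
    | recv r R =>
      refine (prob_send_mode (rounds_ne_nil n) (onLeft_aliceSend_step α x m ρ)).trans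
        ((ih _ _ _).trans (prob_send_mode (rounds_ne_nil n)
          (X := prodState (fun i => pulse α (angle (Fin.tail x i))) ⊗ₖ ketbra m)
          (τ := pulse α (angle (x 0))) (ρ := ρ) ?_).symm)
      rw [prodState_succ, onLeft_kronecker]
      congr 1
      ext p q
      simp only [compress_apply, splitHead, Matrix.kroneckerMap_apply, Fin.cons_zero,
        Fin.tail_cons]
      rw [mul_assoc, mul_comm]
      rfl

/-- Alice is a mixture, over the random bit and angles, of senders with fixed pulses. -/
theorem prob_alice (α : ℂ) (n : ℕ) {B : Type} (R : Responder (rounds n) B Bool)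
    (M : Matrix (ZMod 8 × B) (ZMod 8 × B) ℂ) :
    prob (alice α n) R M = ∑ θ, ∑ m : Bool, ∑ t : Fin (n - 1) → ZMod 8,
      prob (aliceSend α n) R (ketbra (pulseAngles n θ m t, m) ⊗ₖ
        ((1 / (2 * 8 ^ (n - 1)) : ℂ) • compress (fun w => (θ, w)) M)) := by
  obtain ⟨L, hL⟩ := exists_linear_prob (aliceSend_finiteEnd α n) R
  rw [alice, prob_pre _ _ _ _ (rounds_ne_nil n), aliceSample, onLeft_measurePrepare]
  simp only [hL]
  simp only [← Complex.re_sum, ← map_sum]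
  congr 2
  ext p q
  simp only [Matrix.sum_apply, Matrix.kroneckerMap_apply, Finset.sum_mul, Matrix.smul_apply,
    smul_eq_mul]
  refine Finset.sum_congr rfl fun θ _ => Finset.sum_congr rfl fun m _ =>
    Finset.sum_congr rfl fun t _ => by ring

/-! ### Bob's behaviour round by round -/

/-- A pulse in the state `τ` drives Bob's emitter, which adds a mode to the `k` earlier ones. -/
def emitterStep (𝓔 : Superop (Fock × Bool) (Bool × Option Bool)) (k : ℕ)
    (τ : Matrix Fock Fock ℂ) : Superop (Bool × Modes k) (Bool × Modes (k + 1)) :=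
  compress (fun x : Bool × Modes (k + 1) =>
      ((x.1, x.2 (Fin.last k)), fun i : Fin k => x.2 i.castSucc))
    ∘ₗ onLeft (Modes k) (𝓔 ∘ₗ tensorLeft τ)

/-- Bob's last step on the bit `m`, without the message that goes back to Alice. -/
def finalStep (k : ℕ) (m : Bool) : Superop (Bool × Modes k) BobOutput :=
  (∑ b : Bool, compress fun o : BobOutput => (o, b)) ∘ₗ bobConclude k
    ∘ₗ onLeft Bool (onRight (Bool × Bool) (measureModes k))
    ∘ₗ onLeft Bool (onLeft (Modes k) (conj emission)) ∘ₗ tensorRight (ketbra m)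

/-- Bob's output as a function of his state when he holds `k` modes and the angles `x` of the
remaining pulses are fixed. -/
def bobRun (α : ℂ) (𝓔 : Superop (Fock × Bool) (Bool × Option Bool)) :
    (j k : ℕ) → (Fin j → ZMod 8) → Bool → Superop (Bool × Modes k) BobOutput
  | 0, k, _, m => finalStep k m
  | j + 1, k, x, m =>
      bobRun α 𝓔 j (k + 1) (Fin.tail x) m ∘ₗ emitterStep 𝓔 k (pulse α (angle (x 0)))

theorem prob_done {A B : Type} (f : Superop B Bool) (M : Matrix (A × B) (A × B) ℂ) :
    prob (.done : Sender [] A) (.done f) M =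
      ∑' a, (f (M.submatrix (a, ·) (a, ·)) true true).re := rfl

/-- Against Bob's honest converter, the interaction is the one-shot map `bobRun`. -/
theorem prob_aliceSend_bobFrom (α : ℂ) (𝓔 : Superop (Fock × Bool) (Bool × Option Bool))
    {W : Type} (g : Superop (BobOutput × W) Bool) (j k : ℕ) (x : Fin j → ZMod 8) (m : Bool)
    (ρ : Matrix ((Bool × Modes k) × W) ((Bool × Modes k) × W) ℂ) :
    prob (aliceSend α j) ((bobFrom 𝓔 j k).ext W g) (ketbra (x, m) ⊗ₖ ρ) =
      (g (onLeft W (bobRun α 𝓔 j k x m) ρ) true true).re := by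
  induction j generalizing k with
  | zero =>
    refine (prob_send_product (l := []) (X := ketbra ()) (τ := ketbra m) (ρ := ρ) ?_).trans ?_
    · rw [onLeft_kronecker, measurePrepare_ketbra, ketbra_prod]
    · refine (prob_done (A := Unit × Bool) (g ∘ₗ onLeft W LinearMap.id) _).trans ?_
      rw [tsum_fintype, Fintype.sum_prod_type, Fintype.sum_unique, ← Complex.re_sum,
        ← Matrix.sum_apply, ← map_sum]
      refine congrArg (fun N => (g N true true).re) ?_
      change ∑ b : Bool, _ = onLeft W (finalStep k m) ρ
      rw [finalStep, onLeft_comp W (∑ b : Bool, compress _), onLeft_sum]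
      refine Eq.trans ?_ ((LinearMap.comp_apply _ _ _).trans (LinearMap.sum_apply _ _ _)).symm
      refine Finset.sum_congr rfl fun b _ => ?_
      ext p q
      have h1 : ketbra () () () = 1 := by simp [ketbra]
      refine (congrArg (· * _) h1).trans ((one_mul _).trans ?_)
      rfl
  | succ j ih =>
    refine (prob_send_mode (rounds_ne_nil j) (onLeft_aliceSend_step α x m ρ)).trans
      (Eq.trans ?_ (ih (k + 1) (Fin.tail x)
        (onLeft W (emitterStep 𝓔 k (pulse α (angle (x 0)))) ρ)))
    congr 2
    ext p q
    refine congrArg (fun N => 𝓔 N (p.1.1, p.1.2 (Fin.last k)) (q.1.1, q.1.2 (Fin.last k))) ?_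
    ext a b
    exact mul_comm _ _

/-! ### The honest devices are CPTP -/

theorem cpScaling_conj_fintype {X Y : Type} [Fintype X] [DecidableEq X] [Fintype Y]
    (K : Matrix Y X ℂ) (hK : ∀ x x', ∑ y, K y x * star (K y x') = if x = x' then 1 else 0) :
    CPScaling 1 (conj K) :=
  cpScaling_conj K fun x x' => by
    rw [Complex.ofReal_one, ← hK]
    exact hasSum_fintype _

theorem cpScaling_conj_diagonal {X : Type} [Fintype X] [DecidableEq X] {d : X → ℂ}
    (hd : ∀ x, d x * star (d x) = 1) : CPScaling 1 (conj (Matrix.diagonal d)) := by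
  refine cpScaling_conj_fintype _ fun x x' => ?_
  rw [Finset.sum_eq_single x]
  · rcases eq_or_ne x x' with rfl | h
    · rw [Matrix.diagonal_apply_eq, hd, if_pos rfl]
    · simp [h]
  · intro y _ hy
    simp [hy]
  · simp

theorem cpScaling_conj_emission : CPScaling 1 (conj emission) := by
  refine cpScaling_conj_fintype _ fun x x' => ?_
  cases x <;> cases x' <;> simp [emission]

theorem cpScaling_conj_someEmbed {X : Type} [Fintype X] [DecidableEq X] :
    CPScaling 1 (conj (someEmbed X)) := by
  refine cpScaling_conj_fintype _ fun x x' => ?_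
  simp [someEmbed, eq_comm]

theorem one_kronecker_pauliZ_pow (p : ℕ) : ((1 : Matrix Bool Bool ℂ) ⊗ₖ pauliZ) ^ p =
    Matrix.diagonal fun q : Bool × Bool => if q.2 then (-1) ^ p else 1 := by
  rw [pauliZ, ← Matrix.diagonal_one, Matrix.diagonal_kronecker_diagonal, Matrix.diagonal_pow]
  congr 1
  ext ⟨a, b⟩
  cases b <;> simp

theorem detectorAmp_orthonormal (x x' : Option Bool) :
    ∑ r, detectorAmp r x * star (detectorAmp r x') = if x = x' then 1 else 0 := by
  rcases x with _ | _ | _ <;> rcases x' with _ | _ | _ <;>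
    (simp [detectorAmp, Fintype.sum_option, div_eq_mul_inv, inv_sqrt_two_mul_self]; try norm_num)

theorem cpScaling_measureModes (k : ℕ) : CPScaling 1 (measureModes k) := by
  refine CPScaling.kraus _ fun x x' => ?_
  have h : (if x = x' then ((1 : ℝ) : ℂ) else 0) =
      ∏ i, ∑ r, detectorAmp r (x i) * star (detectorAmp r (x' i)) := by
    simp only [detectorAmp_orthonormal]
    split_ifs with hx
    · subst hx; simp
    · obtain ⟨i, hi⟩ := Function.ne_iff.1 hx
      exact (Finset.prod_eq_zero (Finset.mem_univ i) (if_neg hi)).symm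
  rw [h, Finset.prod_univ_sum, Fintype.piFinset_univ]
  have h2 : ∀ {f : Modes k → ℂ} {a : ℂ}, ∑ y, f y = a → HasSum f a := fun h =>
    h ▸ hasSum_fintype _
  refine h2 ?_
  rw [Finset.sum_comm]
  refine Finset.sum_congr rfl fun r _ => ?_
  rw [Finset.sum_eq_single r]
  · simp [Finset.prod_mul_distrib]
  · intro y _ hy
    simp [hy]
  · simp

theorem cpScaling_id {X : Type} : CPScaling 1 (LinearMap.id : Superop X X) :=
  CPScaling.compress_bijective (f := id) Function.bijective_id

theorem cpScaling_traceBit {X : Type} :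
    CPScaling 1 (∑ b : Bool, compress fun o : X => (o, b)) := by
  have := CPScaling.blocks (ι := Bool) (B := fun _ => X) (fun b o => (o, b))
    (Function.bijective_iff_has_inverse.2
      ⟨fun p => ⟨p.2, p.1⟩, fun _ => rfl, fun _ => rfl⟩) fun _ => cpScaling_id
  simpa using this

theorem cpScaling_bobConclude (k : ℕ) : CPScaling 1 (bobConclude k) := by
  rw [bobConclude, ← Fintype.sum_prod_type']
  refine CPScaling.blocks (ι := Modes k × Bool) (B := fun _ => Bool × Bool)
    (fun p q => ((q, p.1), p.2)) (Function.bijective_iff_has_inverse.2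
      ⟨fun p => ⟨(p.1.2, p.2), p.1.1⟩, fun _ => rfl, fun _ => rfl⟩) fun p => ?_
  split_ifs
  · exact CPScaling.measurePrepare fun _ => posTrace_ketbra _
  · have h : CPScaling 1 (conj (((1 : Matrix Bool Bool ℂ) ⊗ₖ pauliZ) ^ parity p.1)) := by
      rw [one_kronecker_pauliZ_pow]
      refine cpScaling_conj_diagonal fun q => ?_
      cases q.2
      · simp
      · rcases neg_one_pow_eq_or ℂ (parity p.1) with h | h <;> simp [h]
    simpa using (CPScaling.tensorRight (posTrace_ketbra false)).comp
      (cpScaling_conj_someEmbed.comp ((CPScaling.tensorLeft (posTrace_ketbra p.2)).comp h))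

theorem cpScaling_finalStep (k : ℕ) (m : Bool) : CPScaling 1 (finalStep k m) := by
  have h := cpScaling_traceBit.comp ((cpScaling_bobConclude k).comp
    ((((cpScaling_measureModes k).onRight (Bool × Bool)).onLeft Bool).comp
      (((cpScaling_conj_emission.onLeft (Modes k)).onLeft Bool).comp
        (CPScaling.tensorRight (posTrace_ketbra m)))))
  rw [finalStep]
  simpa only [mul_one] using h

theorem IsEmitter.cpScaling_emitterStep {α : ℂ} {η : ℝ}
    {𝓔 : Superop (Fock × Bool) (Bool × Option Bool)} (h : IsEmitter α η 𝓔) (k : ℕ)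
    (θ : ZMod 8) : CPScaling 1 (emitterStep 𝓔 k (pulse α (angle θ))) := by
  have h1 : Function.Bijective fun x : Bool × Modes (k + 1) =>
      ((x.1, x.2 (Fin.last k)), fun i : Fin k => x.2 i.castSucc) :=
    Function.bijective_iff_has_inverse.2 ⟨fun p => (p.1.1, Fin.snoc p.2 p.1.2),
      fun p => by
        ext i
        · rfl
        · exact congrFun (Fin.snoc_init_self p.2) i ▸ Iff.rfl,
      fun p => by simp⟩
  rw [emitterStep]
  simpa only [mul_one] using (CPScaling.compress_bijective h1).comp
    ((isCPTP_iff.1 (h.cptp θ)).onLeft (Modes k))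

theorem IsEmitter.cpScaling_bobRun {α : ℂ} {η : ℝ}
    {𝓔 : Superop (Fock × Bool) (Bool × Option Bool)} (h : IsEmitter α η 𝓔) (j k : ℕ)
    (x : Fin j → ZMod 8) (m : Bool) : CPScaling 1 (bobRun α 𝓔 j k x m) := by
  induction j generalizing k with
  | zero => exact cpScaling_finalStep k m
  | succ j ih =>
    rw [bobRun]
    simpa only [mul_one] using (ih (k + 1) (Fin.tail x)).comp (h.cpScaling_emitterStep k (x 0))

/-! ### Bob's output when no photon is missing -/

/-- What the emission of a photon, rotated by `φ`, makes of a spin in the state `σ`, together with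
a classical bit `m`. -/
def rotatedPair (m : Bool) (φ : ZMod 8) (σ : Matrix Bool Bool ℂ) :
    Matrix (Bool × (Bool × Bool)) (Bool × (Bool × Bool)) ℂ := fun a a' =>
  if (a.1 = m ∧ a.2.1 = a.2.2) ∧ (a'.1 = m ∧ a'.2.1 = a'.2.2) then
    phase φ a.2.1 * star (phase φ a'.2.1) * σ a.2.1 a'.2.1 else 0

/-- The block of `ρ` where all modes are occupied is `c` times the result of emitting `k` photons
with total rotation `φ` from a spin in the state `σ`. -/
def IsChain {k : ℕ} (c : ℂ) (φ : ZMod 8) (σ : Matrix Bool Bool ℂ)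
    (ρ : Matrix (Bool × Modes k) (Bool × Modes k) ℂ) : Prop :=
  ∀ (s s' : Bool) (f f' : Fin k → Bool),
    ρ (s, fun i => some (f i)) (s', fun i => some (f' i)) =
      if f = (fun _ => s) ∧ f' = (fun _ => s') then
        c * (phase φ s * star (phase φ s') * σ s s') else 0

theorem conj_rotatedEmission_apply (φ : ZMod 8) (ρ : Matrix Bool Bool ℂ) (s s' y y' : Bool) :
    conj (rotatedEmission (angle φ)) ρ (s, y) (s', y') =
      if y = s ∧ y' = s' then phase φ s * star (phase φ s') * ρ s s' else 0 := by
  have h : ∀ p x, rotatedEmission (angle φ) p x =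
      if p = (x, x) then rotZ (angle φ) x x else 0 := by
    rintro ⟨a, b⟩ x
    simp only [rotatedEmission, Matrix.mul_apply, Matrix.kroneckerMap_apply, emission,
      Matrix.of_apply, Fintype.sum_prod_type, Matrix.one_apply, rotZ, Matrix.diagonal_apply]
    cases a <;> cases b <;> cases x <;> simp
  rw [← rotZ_mul_star]
  simp only [conj_apply, h]
  cases s <;> cases s' <;> cases y <;> cases y' <;> simp <;> ring

/-- Each successful emission multiplies the weight by the efficiency and adds the angle of its pulse. -/
theorem IsEmitter.isChain_emitterStep {α : ℂ} {η : ℝ}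
    {𝓔 : Superop (Fock × Bool) (Bool × Option Bool)} (h : IsEmitter α η 𝓔) {k : ℕ} {c : ℂ}
    {φ : ZMod 8} {σ : Matrix Bool Bool ℂ} {ρ : Matrix (Bool × Modes k) (Bool × Modes k) ℂ}
    (hρ : IsChain c φ σ ρ) (θ : ZMod 8) :
    IsChain (η * c) (φ + θ) σ (emitterStep 𝓔 k (pulse α (angle θ)) ρ) := by
  intro s s' f f'
  have h1 := congrFun (congrFun (h.emits θ (ρ.submatrix
    (fun x => (x, fun i : Fin k => some (f i.castSucc)))
    (fun x => (x, fun i : Fin k => some (f' i.castSucc))))) (s, f (Fin.last k)))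
    (s', f' (Fin.last k))
  refine h1.trans ?_
  rw [Matrix.smul_apply, conj_rotatedEmission_apply, Matrix.submatrix_apply, hρ, phase_add,
    phase_add, star_mul', smul_eq_mul]
  have hf : ∀ (f : Fin (k + 1) → Bool) (s : Bool), (f = fun _ => s) ↔
      f (Fin.last k) = s ∧ (fun i : Fin k => f i.castSucc) = fun _ => s := fun f s => by
    refine ⟨fun h => by simp [h], fun h => ?_⟩
    funext i
    refine Fin.lastCases h.1 (fun i => congrFun h.2 i) i
  simp only [hf]
  by_cases h1 : f (Fin.last k) = s <;> by_cases h2 : f' (Fin.last k) = s' <;>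
    by_cases h3 : (fun i : Fin k => f i.castSucc) = fun _ => s <;>
    by_cases h4 : (fun i : Fin k => f' i.castSucc) = fun _ => s' <;>
    simp [h1, h2, h3, h4]
  ring

theorem ketbra_apply {X : Type} [DecidableEq X] (x y z : X) :
    ketbra x y z = if y = x ∧ z = x then 1 else 0 := by
  simp [ketbra, Matrix.single_apply, eq_comm]

theorem measureModes_diag {k : ℕ} (M : Matrix (Modes k) (Modes k) ℂ) (r : Modes k) :
    measureModes k M r r = ∑ x', (∑ x, (∏ i, detectorAmp (r i) (x i)) * M x x') *
      star (∏ i, detectorAmp (r i) (x' i)) := by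
  rw [measureModes, LinearMap.sum_apply, Matrix.sum_apply, Finset.sum_eq_single r]
  · simp [conj_apply]
  · intro r' _ hr
    simp [conj_apply, hr.symm]
  · simp

theorem prod_detectorAmp_const {k : ℕ} {r : Modes k} (hr : ¬ ∃ i, r i = none) (s : Bool) :
    ∏ i, detectorAmp (r i) (some s) =
      (if s then (-1) ^ parity r else 1) / (Real.sqrt 2 : ℂ) ^ k := by
  have h : ∀ i, detectorAmp (r i) (some s) =
      (if s then (if r i = some true then -1 else 1) else 1) / (Real.sqrt 2 : ℂ) := fun i => by
    rcases hi : r i with _ | _ | _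
    · exact absurd ⟨i, hi⟩ hr
    · cases s <;> simp [detectorAmp]
    · cases s <;> simp [detectorAmp]
  simp only [h, Finset.prod_div_distrib, Finset.prod_const, Finset.card_univ, Fintype.card_fin]
  cases s
  · simp
  · simp [Finset.prod_ite, parity, ← neg_one_pow_eq_pow_mod_two]

theorem prod_detectorAmp_none {k : ℕ} {r x : Modes k} (hr : ¬ ∃ i, r i = none) {i : Fin k}
    (hi : x i = none) : ∏ i, detectorAmp (r i) (x i) = 0 := by
  refine Finset.prod_eq_zero (Finset.mem_univ i) ?_
  rcases h : r i with _ | b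
  · exact absurd ⟨i, h⟩ hr
  · simp [detectorAmp, hi]

theorem sum_modes_some {k : ℕ} (c : ℂ) :
    ∑ r : Modes k, (if ∃ i, r i = none then 0 else c) = 2 ^ k * c := by
  have h := Finset.prod_univ_sum (fun _ : Fin k => (Finset.univ : Finset (Option Bool)))
    fun _ o => if o = none then (0 : ℂ) else 1
  rw [Fintype.piFinset_univ] at h
  have h1 : ∀ r : Modes k, ∏ i, (if r i = none then (0 : ℂ) else 1) =
      if ∃ i, r i = none then 0 else 1 := fun r => by
    split_ifs with hr
    · obtain ⟨i, hi⟩ := hr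
      exact Finset.prod_eq_zero (Finset.mem_univ i) (if_pos hi)
    · exact Finset.prod_eq_one fun i _ => if_neg fun hi => hr ⟨i, hi⟩
  simp only [h1] at h
  have h2 : ∑ o : Option Bool, (if o = none then (0 : ℂ) else 1) = 2 := by
    simp [Fintype.sum_option]
  rw [h2, Finset.prod_const, Finset.card_univ, Fintype.card_fin] at h
  rw [h, Finset.sum_mul]
  exact Finset.sum_congr rfl fun r _ => by split_ifs <;> simp

theorem conj_emission_apply (ρ : Matrix Bool Bool ℂ) (q q' : Bool × Bool) :
    conj emission ρ q q' = if q.1 = q.2 ∧ q'.1 = q'.2 then ρ q.1 q'.1 else 0 := by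
  obtain ⟨s, y⟩ := q
  obtain ⟨s', y'⟩ := q'
  cases s <;> cases s' <;> cases y <;> cases y' <;> simp [conj_apply, emission]

theorem conj_someEmbed_some {X : Type} [Fintype X] [DecidableEq X] (M : Matrix X X ℂ) (a a' : X) :
    conj (someEmbed X) M (some a) (some a') = M a a' := by
  simp [conj_apply, someEmbed]

theorem conj_someEmbed_none {X : Type} [Fintype X] [DecidableEq X] (M : Matrix X X ℂ)
    (a : Option X) : conj (someEmbed X) M none a = 0 := by
  simp [conj_apply, someEmbed]

theorem conj_someEmbed_none_right {X : Type} [Fintype X] [DecidableEq X] (M : Matrix X X ℂ)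
    (a : Option X) : conj (someEmbed X) M a none = 0 := by
  simp [conj_apply, someEmbed]

/-- The state of the spin, all photons, and the record of outcomes, before Bob concludes. -/
def measured (k : ℕ) (ρ : Matrix (Bool × Modes k) (Bool × Modes k) ℂ) :
    Matrix ((Bool × Bool) × Modes k) ((Bool × Bool) × Modes k) ℂ :=
  onRight (Bool × Bool) (measureModes k) (onLeft (Modes k) (conj emission) ρ)

theorem finalStep_apply (k : ℕ) (m : Bool) (ρ : Matrix (Bool × Modes k) (Bool × Modes k) ℂ)
    (o o' : BobOutput) : finalStep k m ρ o o' =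
      ∑ b : Bool, bobConclude k (measured k ρ ⊗ₖ ketbra m) (o, b) (o', b) := by
  have : onLeft Bool (onRight (Bool × Bool) (measureModes k))
      (onLeft Bool (onLeft (Modes k) (conj emission)) (tensorRight (ketbra m) ρ)) =
      measured k ρ ⊗ₖ ketbra m :=
    (congrArg _ (onLeft_kronecker _ _ _)).trans (onLeft_kronecker _ _ _)
  rw [finalStep, LinearMap.comp_apply, LinearMap.sum_apply, Matrix.sum_apply]
  simp only [LinearMap.comp_apply, this]
  rfl

theorem finalStep_none_some (k : ℕ) (m : Bool) (ρ : Matrix (Bool × Modes k) (Bool × Modes k) ℂ)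
    (a : Bool × (Bool × Bool)) :
    finalStep k m ρ none (some a) = 0 ∧ finalStep k m ρ (some a) none = 0 := by
  simp only [finalStep_apply, bobConclude, LinearMap.sum_apply, Matrix.sum_apply]
  constructor
  all_goals
    refine Finset.sum_eq_zero fun b _ => Finset.sum_eq_zero fun r _ => Finset.sum_eq_zero
      fun m' _ => ?_
    split_ifs
    · simp [measurePrepare_apply, Matrix.sum_apply, ketbra]
    · simp only [LinearMap.comp_apply, tensorRight_apply, conj_someEmbed_none,
        conj_someEmbed_none_right, zero_mul]

theorem measured_apply {k : ℕ} {c : ℂ} {φ : ZMod 8} {σ : Matrix Bool Bool ℂ}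
    {ρ : Matrix (Bool × Modes k) (Bool × Modes k) ℂ} (hρ : IsChain c φ σ ρ) {r : Modes k}
    (hr : ¬ ∃ i, r i = none) (q q' : Bool × Bool) :
    measured k ρ (q, r) (q', r) = if q.1 = q.2 ∧ q'.1 = q'.2 then
      (if q.1 then (-1) ^ parity r else 1) * (if q'.1 then (-1) ^ parity r else 1) / 2 ^ k *
        (c * (phase φ q.1 * star (phase φ q'.1) * σ q.1 q'.1)) else 0 := by
  have h2 : (Real.sqrt 2 : ℂ) ^ k * (Real.sqrt 2 : ℂ) ^ k = 2 ^ k := by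
    rw [← mul_pow, ← Complex.ofReal_mul, Real.mul_self_sqrt (by norm_num)]; simp
  rw [measured, onRight_apply, measureModes_diag]
  simp only [Matrix.submatrix_apply, onLeft_apply, conj_emission_apply]
  by_cases hq : q.1 = q.2 ∧ q'.1 = q'.2
  · simp only [if_pos hq]
    -- only the modes in the state `|s … s⟩` of a spin `s` contribute
    have hz : ∀ x x' : Modes k, x ≠ (fun _ => some q.1) ∨ x' ≠ (fun _ => some q'.1) →
        (∏ i, detectorAmp (r i) (x i)) * ρ (q.1, x) (q'.1, x') *
          star (∏ i, detectorAmp (r i) (x' i)) = 0 := by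
      intro x x' hx
      by_cases h1 : ∃ i, x i = none
      · obtain ⟨i, hi⟩ := h1
        rw [prod_detectorAmp_none hr hi, zero_mul, zero_mul]
      by_cases h1' : ∃ i, x' i = none
      · obtain ⟨i, hi⟩ := h1'
        rw [prod_detectorAmp_none hr hi, star_zero, mul_zero]
      simp only [not_exists, ← ne_eq, Option.ne_none_iff_exists'] at h1 h1'
      choose f hf using h1
      choose f' hf' using h1'
      obtain rfl : x = fun i => some (f i) := funext hf
      obtain rfl : x' = fun i => some (f' i) := funext hf'
      rw [hρ, if_neg, mul_zero, zero_mul]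
      rintro ⟨rfl, rfl⟩
      simp at hx
    simp only [Finset.sum_mul]
    rw [Finset.sum_eq_single fun _ => some q'.1, Finset.sum_eq_single fun _ => some q.1]
    · have := hρ q.1 q'.1 (fun _ => q.1) (fun _ => q'.1)
      rw [if_pos ⟨rfl, rfl⟩] at this
      dsimp only at this ⊢
      rw [this, prod_detectorAmp_const hr, prod_detectorAmp_const hr, ← h2]
      have hs : star (Real.sqrt 2 : ℂ) = Real.sqrt 2 := Complex.conj_ofReal _
      cases q.1 <;> cases q'.1 <;> simp only [star_div₀, star_pow, hs] <;> simp <;> ring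
    · exact fun x _ hx => hz x _ (Or.inl hx)
    · simp
    · exact fun x' _ hx' => Finset.sum_eq_zero fun x _ => hz x x' (Or.inr hx')
    · simp
  · simp [hq]

/-- When no photon is missing, Bob's correction `Z ^ b` undoes the effect of the outcomes. -/
theorem finalStep_some {k : ℕ} {c : ℂ} {φ : ZMod 8} {σ : Matrix Bool Bool ℂ}
    {ρ : Matrix (Bool × Modes k) (Bool × Modes k) ℂ} (hρ : IsChain c φ σ ρ) (m : Bool)
    (a a' : Bool × (Bool × Bool)) :
    finalStep k m ρ (some a) (some a') = c * rotatedPair m φ σ a a' := by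
  have hterm : ∀ (r : Modes k) (m' b : Bool),
      ((if ∃ i, r i = none then
          measurePrepare fun _ => ketbra ((none : BobOutput), true)
        else
          tensorRight (ketbra false)
            ∘ₗ conj (someEmbed _)
            ∘ₗ tensorLeft (ketbra m')
            ∘ₗ conj (((1 : Matrix Bool Bool ℂ) ⊗ₖ pauliZ) ^ parity r))
        ∘ₗ compress (fun q : Bool × Bool => ((q, r), m'))) (measured k ρ ⊗ₖ ketbra m)
          (some a, b) (some a', b) = if m' = m ∧ b = false then
            (if ∃ i, r i = none then 0 else c / 2 ^ k * rotatedPair m φ σ a a') else 0 := by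
    intro r m' b
    by_cases hr : ∃ i, r i = none
    · simp [hr, measurePrepare_apply, Matrix.sum_apply, ketbra]
    · rw [if_neg hr, if_neg hr]
      simp only [LinearMap.comp_apply, tensorRight_apply, conj_someEmbed_some, tensorLeft_apply,
        one_kronecker_pauliZ_pow, conj_diagonal_apply, compress_apply, Matrix.kroneckerMap_apply,
        measured_apply hρ hr, rotatedPair, ketbra_apply]
      obtain ⟨m1, s, y⟩ := a
      obtain ⟨m1', s', y'⟩ := a'
      by_cases hq : s = y ∧ s' = y'
      · obtain ⟨rfl, rfl⟩ := hq
        by_cases hm : m' = m ∧ b = false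
        · obtain ⟨rfl, rfl⟩ := hm
          by_cases h1 : m1 = m' ∧ m1' = m'
          · obtain ⟨rfl, rfl⟩ := h1
            rcases neg_one_pow_eq_or ℂ (parity r) with h | h <;> cases s <;> cases s' <;>
              simp [h] <;> ring
          · have h2 : ¬ ((m1 = m' ∧ s = s) ∧ (m1' = m' ∧ s' = s')) := fun h =>
              h1 ⟨h.1.1, h.2.1⟩
            rw [if_neg h1, if_pos (show m' = m' ∧ false = false from ⟨rfl, rfl⟩)]
            refine Eq.trans (b := c / 2 ^ k * 0) (by simp) ?_
            exact congrArg (c / 2 ^ k * ·) (if_neg h2).symm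
        · rw [if_neg hm]
          by_cases hm' : m' = m
          · have : ¬ b = false := fun h => hm ⟨hm', h⟩
            simp [this, eq_comm]
          · have : ¬ (m' = m ∧ m' = m) := fun h => hm' h.1
            simp only [if_neg this]
            simp
      · have h2 : ¬ ((m1 = m ∧ s = y) ∧ (m1' = m ∧ s' = y')) := fun h => hq ⟨h.1.2, h.2.2⟩
        simp only [if_neg hq, if_neg h2]
        simp
  simp only [finalStep_apply, bobConclude, LinearMap.sum_apply, Matrix.sum_apply]
  simp only [hterm]
  rw [Finset.sum_comm]
  simp only [Fintype.sum_bool]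
  have h2 : (2 : ℂ) ^ k ≠ 0 := by positivity
  have h3 := sum_modes_some (k := k) (c / 2 ^ k * rotatedPair m φ σ a a')
  cases m <;> simp [h3] <;> field_simp

/-! ### Correctness of the protocol with an honest Bob -/

theorem sum_pulseAngles {n : ℕ} (hn : 1 ≤ n) (θ : ZMod 8) (m : Bool) (t : Fin (n - 1) → ZMod 8) :
    ∑ i, pulseAngles n θ m t i = signed m θ := by
  obtain ⟨n, rfl⟩ : ∃ k, n = k + 1 := ⟨n - 1, by omega⟩
  rw [Fin.sum_univ_castSucc]
  have h1 : ∀ i : Fin n, pulseAngles (n + 1) θ m t i.castSucc = t i := fun i => by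
    simp [pulseAngles]
  have h2 : pulseAngles (n + 1) θ m t (Fin.last n) = signed m θ - ∑ j, t j := by
    simp [pulseAngles]
  rw [h2, Finset.sum_congr rfl fun i _ => h1 i]
  exact add_sub_cancel _ _

/-- The part of Bob's output without `Abort` has weight `η ^ j`, and depends on the angles of the
pulses only through their sum. -/
theorem IsEmitter.bobRun_some {α : ℂ} {η : ℝ}
    {𝓔 : Superop (Fock × Bool) (Bool × Option Bool)} (h : IsEmitter α η 𝓔) (j : ℕ) {k : ℕ}
    (x : Fin j → ZMod 8) (m : Bool) {c : ℂ} {φ : ZMod 8} {σ : Matrix Bool Bool ℂ}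
    {ρ : Matrix (Bool × Modes k) (Bool × Modes k) ℂ} (hρ : IsChain c φ σ ρ)
    (a a' : Bool × (Bool × Bool)) :
    bobRun α 𝓔 j k x m ρ (some a) (some a') =
      (η : ℂ) ^ j * c * rotatedPair m (φ + ∑ i, x i) σ a a' := by
  induction j generalizing k c φ with
  | zero => simpa [bobRun] using finalStep_some hρ m a a'
  | succ j ih =>
    refine (ih (Fin.tail x) (h.isChain_emitterStep hρ (x 0))).trans ?_
    rw [Fin.sum_univ_succ, ← add_assoc, pow_succ]
    simp only [Fin.tail]
    ring

theorem bobRun_none_some (α : ℂ) (𝓔 : Superop (Fock × Bool) (Bool × Option Bool)) (j k : ℕ)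
    (x : Fin j → ZMod 8) (m : Bool) (ρ : Matrix (Bool × Modes k) (Bool × Modes k) ℂ)
    (a : Bool × (Bool × Bool)) :
    bobRun α 𝓔 j k x m ρ none (some a) = 0 ∧ bobRun α 𝓔 j k x m ρ (some a) none = 0 := by
  induction j generalizing k with
  | zero => exact finalStep_none_some k m ρ a
  | succ j ih => exact ih (k + 1) (Fin.tail x) _

/-- The map from the inputs of Alice and Bob to Bob's output that the honest protocol realises. -/
def honestRun (α : ℂ) (𝓔 : Superop (Fock × Bool) (Bool × Option Bool)) (n : ℕ) :
    Superop (ZMod 8 × Bool) BobOutput :=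
  ∑ θ, (∑ m : Bool, ∑ t : Fin (n - 1) → ZMod 8, ((1 / (2 * 8 ^ (n - 1)) : ℝ) : ℂ) •
    (bobRun α 𝓔 n 0 (pulseAngles n θ m t) m ∘ₗ compress fun x => x.1))
      ∘ₗ compress (fun s : Bool => (θ, s))

theorem sum_uniform (n : ℕ) :
    ∑ _m : Bool, ∑ _t : Fin n → ZMod 8, (1 / (2 * 8 ^ n) : ℝ) * 1 = 1 := by
  simp [ZMod.card]

theorem cpScaling_inputBlocks {Y : Type} {c : ℝ} {Φ : ZMod 8 → Superop Bool Y}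
    (h : ∀ θ, CPScaling c (Φ θ)) :
    CPScaling c (∑ θ, Φ θ ∘ₗ compress (fun s : Bool => (θ, s))) :=
  CPScaling.blocks (B := fun _ => Bool) (fun θ s => (θ, s)) (Function.bijective_iff_has_inverse.2
    ⟨fun p => ⟨p.1, p.2⟩, fun _ => rfl, fun _ => rfl⟩) h

theorem IsEmitter.cpScaling_honestRun {α : ℂ} {η : ℝ}
    {𝓔 : Superop (Fock × Bool) (Bool × Option Bool)} (h : IsEmitter α η 𝓔) (n : ℕ) :
    CPScaling 1 (honestRun α 𝓔 n) := by
  refine cpScaling_inputBlocks fun θ => ?_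
  have hf : Function.Bijective fun x : Bool × Modes 0 => x.1 :=
    Function.bijective_iff_has_inverse.2 ⟨fun s => (s, default), fun x =>
      Prod.ext rfl (Subsingleton.elim _ _), fun _ => rfl⟩
  have h1 : ∀ m t, CPScaling 1 (bobRun α 𝓔 n 0 (pulseAngles n θ m t) m ∘ₗ
      compress fun x : Bool × Modes 0 => x.1) := fun m t => by
    simpa only [mul_one] using
      (h.cpScaling_bobRun n 0 (pulseAngles n θ m t) m).comp (CPScaling.compress_bijective hf)
  have hr : (0 : ℝ) ≤ 1 / (2 * 8 ^ (n - 1)) := by positivity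
  have h2 := CPScaling.sum Finset.univ fun m _ =>
    CPScaling.sum Finset.univ fun t _ => (h1 m t).smul hr
  rwa [sum_uniform] at h2

/-- The Blind Graph State Extender on the input `θ` of Alice. -/
def extend (θ : ZMod 8) : Superop Bool BobOutput :=
  ∑ b : Bool, ((1 / 2 : ℝ) : ℂ) • (conj (someEmbed _) ∘ₗ tensorLeft (ketbra b)
    ∘ₗ conj (((1 : Matrix Bool Bool ℂ) ⊗ₖ rotZ (angle (signed b θ))) * cnot)
    ∘ₗ tensorRight (ketbra false))

theorem graphStateExtender_eq :
    graphStateExtender = ∑ θ, extend θ ∘ₗ compress (fun s : Bool => (θ, s)) := by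
  refine Finset.sum_congr rfl fun θ _ => ?_
  ext M p q
  simp only [extend, LinearMap.sum_apply, LinearMap.smul_apply, LinearMap.comp_apply]
  norm_num

theorem rotated_cnot_apply (φ : ZMod 8) (p q : Bool × Bool) :
    (((1 : Matrix Bool Bool ℂ) ⊗ₖ rotZ (angle φ)) * cnot) p q =
      if p = (q.1, xor q.1 q.2) then rotZ (angle φ) p.2 p.2 else 0 := by
  obtain ⟨s, y⟩ := p
  obtain ⟨s', y'⟩ := q
  simp only [Matrix.mul_apply, Matrix.kroneckerMap_apply, cnot, Matrix.of_apply,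
    Fintype.sum_prod_type, Matrix.one_apply, rotZ, Matrix.diagonal_apply]
  cases s <;> cases y <;> cases s' <;> cases y' <;> simp

theorem cpScaling_extend (θ : ZMod 8) : CPScaling 1 (extend θ) := by
  have h1 : (1 : ℝ) = ∑ _b : Bool, (1 / 2 : ℝ) * 1 := by simp
  rw [h1]
  refine CPScaling.sum _ fun b _ => CPScaling.smul ?_ (by norm_num)
  have h2 : CPScaling 1
      (conj (((1 : Matrix Bool Bool ℂ) ⊗ₖ rotZ (angle (signed b θ))) * cnot)) := by
    refine cpScaling_conj_fintype _ fun x x' => ?_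
    have h3 : ∀ y, rotZ (angle (signed b θ)) y y * star (rotZ (angle (signed b θ)) y y) = 1 :=
      fun y => (rotZ_mul_star _ y y).trans (phase_mul_star _ y)
    simp only [rotated_cnot_apply]
    rw [Finset.sum_eq_single (x.1, xor x.1 x.2)]
    · obtain ⟨s, y⟩ := x
      obtain ⟨s', y'⟩ := x'
      cases s <;> cases y <;> cases s' <;> cases y' <;> first | (simp; done) | simpa using h3 _
    · intro y _ hy
      simp [hy]
    · simp
  simpa only [mul_one] using cpScaling_conj_someEmbed.comp
    ((CPScaling.tensorLeft (posTrace_ketbra b)).comp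
      (h2.comp (CPScaling.tensorRight (posTrace_ketbra false))))

theorem cpScaling_graphStateExtender : CPScaling 1 graphStateExtender := by
  rw [graphStateExtender_eq]
  exact cpScaling_inputBlocks cpScaling_extend

theorem extend_some (θ : ZMod 8) (σ : Matrix Bool Bool ℂ) (a a' : Bool × (Bool × Bool)) :
    extend θ σ (some a) (some a') = ∑ b : Bool, 1 / 2 * rotatedPair b (signed b θ) σ a a' := by
  simp only [extend, LinearMap.sum_apply, Matrix.sum_apply, LinearMap.smul_apply,
    Matrix.smul_apply, LinearMap.comp_apply, conj_someEmbed_some, tensorLeft_apply, smul_eq_mul]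
  refine Finset.sum_congr rfl fun b _ => ?_
  have h : conj (((1 : Matrix Bool Bool ℂ) ⊗ₖ rotZ (angle (signed b θ))) * cnot)
      (tensorRight (ketbra false) σ) a.2 a'.2 = if a.2.1 = a.2.2 ∧ a'.2.1 = a'.2.2 then
        phase (signed b θ) a.2.1 * star (phase (signed b θ) a'.2.1) * σ a.2.1 a'.2.1 else 0 := by
    obtain ⟨m, s, y⟩ := a
    obtain ⟨m', s', y'⟩ := a'
    rw [← rotZ_mul_star]
    simp only [conj_apply, rotated_cnot_apply, tensorRight_apply, Fintype.sum_prod_type,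
      ketbra_apply]
    cases s <;> cases y <;> cases s' <;> cases y' <;> simp <;> ring
  rw [h, rotatedPair, ketbra_apply]
  by_cases h1 : a.1 = b <;> by_cases h2 : a'.1 = b <;> by_cases h3 : a.2.1 = a.2.2 <;>
    by_cases h4 : a'.2.1 = a'.2.2 <;> simp [h1, h2, h3, h4]

theorem extend_none (θ : ZMod 8) (σ : Matrix Bool Bool ℂ) (o : BobOutput) :
    extend θ σ none o = 0 ∧ extend θ σ o none = 0 := by
  simp [extend, conj_someEmbed_none, conj_someEmbed_none_right]

/-- When no photon is missing, the honest protocol does the same as the ideal resource. -/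
theorem IsEmitter.honestRun_some {α : ℂ} {η : ℝ}
    {𝓔 : Superop (Fock × Bool) (Bool × Option Bool)} (h : IsEmitter α η 𝓔) {n : ℕ} (hn : 1 ≤ n)
    (M : Matrix (ZMod 8 × Bool) (ZMod 8 × Bool) ℂ) (a a' : Bool × (Bool × Bool)) :
    honestRun α 𝓔 n M (some a) (some a') =
      (η : ℂ) ^ n * graphStateExtender M (some a) (some a') := by
  rw [graphStateExtender_eq, honestRun]
  simp only [LinearMap.sum_apply, Matrix.sum_apply, LinearMap.smul_apply, Matrix.smul_apply,
    LinearMap.comp_apply, extend_some, Finset.mul_sum, smul_eq_mul]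
  refine Finset.sum_congr rfl fun θ _ => Finset.sum_congr rfl fun m _ => ?_
  have h0 : IsChain 1 0 (compress (fun s : Bool => (θ, s)) M)
      (compress (fun x : Bool × Modes 0 => x.1) (compress (fun s : Bool => (θ, s)) M)) := by
    intro s s' f f'
    rw [if_pos ⟨Subsingleton.elim _ _, Subsingleton.elim _ _⟩]
    simp [phase_zero, compress_apply]
  have h1 : ∀ t, _ := fun t => h.bobRun_some n (pulseAngles n θ m t) m h0 a a'
  simp only [h1, sum_pulseAngles hn, zero_add, Finset.sum_const, Finset.card_univ]
  simp [ZMod.card]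
  field_simp

theorem honestRun_none_some (α : ℂ) (𝓔 : Superop (Fock × Bool) (Bool × Option Bool)) (n : ℕ)
    (M : Matrix (ZMod 8 × Bool) (ZMod 8 × Bool) ℂ) (a : Bool × (Bool × Bool)) :
    honestRun α 𝓔 n M none (some a) = 0 ∧ honestRun α 𝓔 n M (some a) none = 0 := by
  simp only [honestRun, LinearMap.sum_apply, Matrix.sum_apply, LinearMap.smul_apply,
    Matrix.smul_apply, LinearMap.comp_apply, bobRun_none_some]
  simp

theorem graphStateExtender_none (M : Matrix (ZMod 8 × Bool) (ZMod 8 × Bool) ℂ) (o : BobOutput) :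
    graphStateExtender M none o = 0 ∧ graphStateExtender M o none = 0 := by
  simp [graphStateExtender_eq, Matrix.sum_apply, extend_none]

theorem IsEmitter.efficiency_mem {α : ℂ} {η : ℝ}
    {𝓔 : Superop (Fock × Bool) (Bool × Option Bool)} (h : IsEmitter α η 𝓔) : 0 ≤ η ∧ η ≤ 1 := by
  have h1 := (isCPTP_iff.1 (h.cptp 0)).posTrace (posTrace_ketbra false)
  have h2 := congrFun (congrFun (h.emits 0 (ketbra false)) (false, false)) (false, false)
  have h3 : (𝓔 ∘ₗ tensorLeft (pulse α (angle 0))) (ketbra false) (false, some false)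
      (false, some false) = η := by
    refine h2.trans ?_
    rw [Matrix.smul_apply, conj_rotatedEmission_apply, phase_mul_star]
    simp [ketbra]
  have h4 := posSemidef_re_diag_nonneg h1.1 (false, some false)
  have h5 := h1.diag_le (false, some false)
  rw [h3, Complex.ofReal_re] at h4 h5
  exact ⟨h4, by simpa using h5⟩

theorem posSemidef_restrict {X : Type} {M : Matrix X X ℂ} (hM : M.PosSemidef) (P : X → Prop)
    [DecidablePred P] : (Matrix.of fun x y => if P x ∧ P y then M x y else 0).PosSemidef := by
  refine posSemidef_of_finset fun s => ?_
  classical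
  have := (hM.submatrix fun x : s => (x : X)).mul_mul_conjTranspose_same
    (Matrix.diagonal fun x : s => if P x then (1 : ℂ) else 0)
  convert this using 1
  ext x y
  by_cases hx : P x <;> by_cases hy : P y <;> simp [Matrix.diagonal_conjTranspose, hx, hy]

/-- The output of the honest protocol is `η ^ n` times the ideal one plus an aborting part of
trace `1 - η ^ n`. -/
theorem IsEmitter.posTrace_abort {α : ℂ} {η : ℝ}
    {𝓔 : Superop (Fock × Bool) (Bool × Option Bool)} (h : IsEmitter α η 𝓔) {n : ℕ} (hn : 1 ≤ n)
    {W : Type} {M : Matrix ((ZMod 8 × Bool) × W) ((ZMod 8 × Bool) × W) ℂ} (hM : PosTrace 1 M) :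
    PosTrace (1 - η ^ n) (onLeft W (honestRun α 𝓔 n) M
      - ((η ^ n : ℝ) : ℂ) • onLeft W graphStateExtender M) := by
  have hZ := (h.cpScaling_honestRun n).posTrace_onLeft hM
  have hI := cpScaling_graphStateExtender.posTrace_onLeft hM
  rw [mul_one] at hZ hI
  constructor
  · convert posSemidef_restrict hZ.1 (fun p : BobOutput × W => p.1 = none) using 1
    ext ⟨o, w⟩ ⟨o', w'⟩
    rw [Matrix.sub_apply, Matrix.smul_apply, onLeft_apply, onLeft_apply, Matrix.of_apply,
      onLeft_apply]
    rcases o with _ | a <;> rcases o' with _ | a' <;>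
      simp [h.honestRun_some hn, honestRun_none_some, graphStateExtender_none]
  · simpa using hZ.2.sub (hI.2.mul_left ((η ^ n : ℝ) : ℂ))

theorem Responder.ext_pre_compress {l : List (Type × Type)} {B B₀ O O' W : Type}
    (R : Responder l B O) (f : B → B₀) (g : Superop (O × W) O') :
    (R.pre (compress f)).ext W g = (R.ext W g).pre (compress (Prod.map f id)) := by
  cases R <;> rfl

theorem onLeft_honestRun (α : ℂ) (𝓔 : Superop (Fock × Bool) (Bool × Option Bool)) (n : ℕ)
    {W : Type} (M : Matrix ((ZMod 8 × Bool) × W) ((ZMod 8 × Bool) × W) ℂ) :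
    onLeft W (honestRun α 𝓔 n) M = ∑ θ, ∑ m : Bool, ∑ t : Fin (n - 1) → ZMod 8,
      onLeft W (bobRun α 𝓔 n 0 (pulseAngles n θ m t) m) ((1 / (2 * 8 ^ (n - 1)) : ℂ) •
        compress (fun w => (θ, w)) (compress (Prod.map id (Prod.map (fun x => x.1) id))
          (compress (Equiv.prodAssoc _ _ _).symm M))) := by
  ext p q
  simp only [honestRun, onLeft_apply, LinearMap.sum_apply, Matrix.sum_apply, LinearMap.comp_apply,
    LinearMap.smul_apply, map_smul, Matrix.smul_apply]
  refine Finset.sum_congr rfl fun θ _ => Finset.sum_congr rfl fun m _ =>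
    Finset.sum_congr rfl fun t _ => ?_
  push_cast
  rfl

/-- With an honest Bob, the protocol can be told from the ideal resource only when a photon is
missing. -/
theorem IsEmitter.correctness {α : ℂ} {η : ℝ}
    {𝓔 : Superop (Fock × Bool) (Bool × Option Bool)} (h : IsEmitter α η 𝓔) {n : ℕ} (hn : 1 ≤ n) :
    Indist (1 - η ^ n) (oneShot (interact (alice α n) (bob 𝓔 n)).2)
      (oneShot (tensorLeft (ketbra ()) ∘ₗ graphStateExtender)) := by
  intro D hD
  obtain ⟨g, hg, hgT⟩ := exists_probOne_oneShot D hD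
  have hM := hD.1.posTrace
  have hreal : probOne D (oneShot (interact (alice α n) (bob 𝓔 n)).2) =
      (g (onLeft D.W (honestRun α 𝓔 n) D.init) true true).re := by
    rw [hgT, tsum_interact_ext, bob, Responder.ext_pre_compress,
      prob_pre_compress _ _ _ _ (rounds_ne_nil n), prob_alice]
    simp only [prob_aliceSend_bobFrom, ← Complex.re_sum, ← Matrix.sum_apply, ← map_sum]
    rw [← onLeft_honestRun]
  have hideal : probOne D (oneShot (tensorLeft (ketbra ()) ∘ₗ graphStateExtender)) =
      (g (onLeft D.W graphStateExtender D.init) true true).re := by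
    rw [hgT, tsum_fintype, Fintype.sum_unique, onRight_apply]
    refine congrArg (fun N => (g N true true).re) ?_
    ext p q
    have h1 : ketbra () () () = 1 := by simp [ketbra]
    exact (congrArg (· * _) h1).trans (one_mul _)
  have hη := h.efficiency_mem
  have hab := (isCPTP_iff.1 hg).posTrace (h.posTrace_abort hn hM)
  have hid := (isCPTP_iff.1 hg).posTrace (cpScaling_graphStateExtender.posTrace_onLeft hM)
  rw [map_sub, map_smul] at hab
  have h1 := posSemidef_re_diag_nonneg hab.1 true
  have h2 := hab.diag_le true
  have h3 := posSemidef_re_diag_nonneg hid.1 true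
  have h4 := hid.diag_le true
  rw [Matrix.sub_apply, Matrix.smul_apply, smul_eq_mul, Complex.sub_re, Complex.re_ofReal_mul]
    at h1 h2
  have h5 : η ^ n ≤ 1 := pow_le_one₀ hη.1 hη.2
  -- `real - η ^ n * ideal` and `ideal` lie in `[0, 1 - η ^ n]` and `[0, 1]`
  rw [hreal, hideal, abs_le]
  constructor <;> nlinarith

/-! ### Averages over the angles of the pulses -/

/-- The average of `τ (t 0) ⊗ … ⊗ τ (t (n - 1))` over the angles `t` with sum `φ`. For `n = 0` it
is `8` times the indicator of `φ = 0`, which makes the recursion in `n` uniform. -/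
def sumAverage (τ : ZMod 8 → Matrix Fock Fock ℂ) (n : ℕ) (φ : ZMod 8) :
    Matrix (Fin n → Fock) (Fin n → Fock) ℂ :=
  ((8 / 8 ^ n : ℝ) : ℂ) • ∑ t : Fin n → ZMod 8,
    if ∑ i, t i = φ then prodState fun i => τ (t i) else 0

/-- The average of `τ (t 0) ⊗ … ⊗ τ (t (n - 1))` over all angles `t`. -/
def freeAverage (τ : ZMod 8 → Matrix Fock Fock ℂ) (n : ℕ) :
    Matrix (Fin n → Fock) (Fin n → Fock) ℂ :=
  ((1 / 8 ^ n : ℝ) : ℂ) • ∑ t : Fin n → ZMod 8, prodState fun i => τ (t i)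

/-- Puts a mode in the state `τ` in front of `n` modes. -/
def consMode (n : ℕ) (τ : Matrix Fock Fock ℂ) : Superop (Fin n → Fock) (Fin (n + 1) → Fock) :=
  compress (splitHead n) ∘ₗ tensorLeft τ

theorem consMode_add (n : ℕ) (τ τ' : Matrix Fock Fock ℂ) :
    consMode n (τ + τ') = consMode n τ + consMode n τ' := by
  ext M p q
  simp [consMode, compress_apply, tensorLeft_apply, add_mul]

theorem sum_fin_succ {n : ℕ} {V : Type} [AddCommMonoid V] (f : (Fin (n + 1) → ZMod 8) → V) :
    ∑ t, f t = ∑ t₀, ∑ t : Fin n → ZMod 8, f (Fin.cons t₀ t) := by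
  rw [← (Fin.consEquiv fun _ => ZMod 8).sum_comp, Fintype.sum_prod_type]
  rfl

theorem prodState_cons {n : ℕ} (τ : ZMod 8 → Matrix Fock Fock ℂ) (t₀ : ZMod 8)
    (t : Fin n → ZMod 8) :
    prodState (fun i => τ ((Fin.cons t₀ t : Fin (n + 1) → ZMod 8) i)) =
      consMode n (τ t₀) (prodState fun i => τ (t i)) := by
  rw [prodState_succ]
  rfl

theorem sumAverage_succ (τ : ZMod 8 → Matrix Fock Fock ℂ) (n : ℕ) (φ : ZMod 8) :
    sumAverage τ (n + 1) φ = ∑ t₀, ((1 / 8 : ℝ) : ℂ) •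
      consMode n (τ t₀) (sumAverage τ n (φ - t₀)) := by
  have h : ∀ (t₀ : ZMod 8) (t : Fin n → ZMod 8),
      (∑ i, (Fin.cons t₀ t : Fin (n + 1) → ZMod 8) i = φ) ↔ ∑ i, t i = φ - t₀ := fun t₀ t => by
    rw [Fin.sum_univ_succ, Fin.cons_zero, eq_sub_iff_add_eq']
    simp
  simp only [sumAverage, sum_fin_succ, h, prodState_cons, map_smul, map_sum, smul_smul,
    Finset.smul_sum, apply_ite (consMode n _), map_zero]
  refine Finset.sum_congr rfl fun t₀ _ => Finset.sum_congr rfl fun t _ => ?_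
  congr 1
  push_cast
  field_simp
  ring

theorem freeAverage_succ (τ : ZMod 8 → Matrix Fock Fock ℂ) (n : ℕ) :
    freeAverage τ (n + 1) = ∑ t₀, ((1 / 8 : ℝ) : ℂ) • consMode n (τ t₀) (freeAverage τ n) := by
  simp only [freeAverage, sum_fin_succ, prodState_cons, map_smul, map_sum, smul_smul,
    Finset.smul_sum]
  refine Finset.sum_congr rfl fun t₀ _ => Finset.sum_congr rfl fun t _ => ?_
  congr 1
  push_cast
  field_simp
  ring

/-- Choosing all angles but the first one freely. -/
theorem sum_consMode_sumAverage (κ τ : ZMod 8 → Matrix Fock Fock ℂ) (n : ℕ) (φ : ZMod 8) :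
    ∑ t₀, ((1 / 8 : ℝ) : ℂ) • consMode n (κ t₀) (sumAverage τ n (φ - t₀)) =
      ∑ t : Fin n → ZMod 8, ((1 / 8 ^ n : ℝ) : ℂ) •
        consMode n (κ (φ - ∑ i, t i)) (prodState fun i => τ (t i)) := by
  simp only [sumAverage, map_smul, map_sum, smul_smul, Finset.smul_sum]
  rw [Finset.sum_comm]
  refine Finset.sum_congr rfl fun t _ => ?_
  rw [Finset.sum_eq_single (φ - ∑ i, t i)]
  · rw [if_pos (by ring)]
    congr 1
    push_cast
    field_simp
  · intro t₀ _ h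
    rw [if_neg fun h' => h (by rw [h']; ring), map_zero, smul_zero]
  · simp

theorem posTrace_freeAverage {τ : ZMod 8 → Matrix Fock Fock ℂ} {c : ℝ}
    (h : ∀ θ, PosTrace c (τ θ)) (n : ℕ) : PosTrace (c ^ n) (freeAverage τ n) := by
  have h1 := (PosTrace.sum Finset.univ fun (t : Fin n → ZMod 8) _ =>
    posTrace_prodState fun i => h (t i)).smul (show (0 : ℝ) ≤ 1 / 8 ^ n by positivity)
  have h2 : 1 / 8 ^ n * ∑ _t : Fin n → ZMod 8, c ^ n = c ^ n := by
    simp [ZMod.card]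
  rwa [h2] at h1

theorem signed_false (φ : ZMod 8) : signed false φ = φ := by simp [signed]

theorem pulseAngles_signed (n : ℕ) (θ : ZMod 8) (m : Bool) :
    pulseAngles n θ m = pulseAngles n (signed m θ) false := by
  funext t i
  unfold pulseAngles
  rw [signed_false]

/-- A uniform choice of angles with the sum `φ` amounts to a uniform choice of all but the last. -/
theorem sumAverage_eq {n : ℕ} (hn : 1 ≤ n) (τ : ZMod 8 → Matrix Fock Fock ℂ) (φ : ZMod 8) :
    sumAverage τ n φ = ((1 / 8 ^ (n - 1) : ℝ) : ℂ) • ∑ t : Fin (n - 1) → ZMod 8,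
      prodState fun i => τ (pulseAngles n φ false t i) := by
  obtain ⟨n, rfl⟩ : ∃ k, n = k + 1 := ⟨n - 1, by omega⟩
  have h1 : ∀ t : Fin n → ZMod 8,
      pulseAngles (n + 1) φ false t = Fin.snoc t (φ - ∑ i, t i) := fun t => by
    funext i
    refine Fin.lastCases ?_ (fun i => ?_) i
    · simp [pulseAngles, signed_false]
    · simp [pulseAngles]
  rw [sumAverage, ← (Fin.snocEquiv fun _ => ZMod 8).sum_comp, Fintype.sum_prod_type,
    Finset.sum_comm]
  congr 1
  · congr 1
    simp
    field_simp
    ring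
  refine Finset.sum_congr rfl fun t _ => ?_
  have h2 : ∀ t₀ : ZMod 8, ∑ i, (Fin.snoc t t₀ : Fin (n + 1) → ZMod 8) i = ∑ i, t i + t₀ :=
    fun t₀ => by rw [Fin.sum_univ_castSucc]; simp
  rw [Finset.sum_eq_single (φ - ∑ i, t i)]
  · refine (if_pos ((h2 _).trans (by ring))).trans ?_
    exact congrArg (fun x => prodState fun i => τ (x i)) (h1 t).symm
  · intro t₀ _ h
    exact if_neg fun h' => h (eq_sub_of_add_eq' ((h2 t₀).symm.trans h'))
  · simp

theorem posTrace_sumAverage {τ : ZMod 8 → Matrix Fock Fock ℂ} {c : ℝ}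
    (h : ∀ θ, PosTrace c (τ θ)) {n : ℕ} (hn : 1 ≤ n) (φ : ZMod 8) :
    PosTrace (c ^ n) (sumAverage τ n φ) := by
  rw [sumAverage_eq hn]
  have h1 := (PosTrace.sum Finset.univ fun (t : Fin (n - 1) → ZMod 8) _ =>
    posTrace_prodState fun i => h (pulseAngles n φ false t i)).smul
      (show (0 : ℝ) ≤ 1 / 8 ^ (n - 1) by positivity)
  have h2 : 1 / 8 ^ (n - 1) * ∑ _t : Fin (n - 1) → ZMod 8, c ^ n = c ^ n := by
    simp [ZMod.card]
  rwa [h2] at h1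

/-! ### The simulated pulses -/

/-- From a qubit in the state `|+_φ⟩`, prepares `n` pulses whose angles add up to `φ`: the qubit,
rotated back by the angles of all other pulses, is put into the first pulse that contains at most
one photon. If all pulses contain at least two photons, the qubit is discarded. -/
def simModes (α : ℂ) : (n : ℕ) → Superop Bool (Fin n → Fock)
  | 0 => measurePrepare fun _ => ketbra default
  | n + 1 =>
    (∑ t : Fin n → ZMod 8, ((1 / 8 ^ n : ℝ) : ℂ) • (compress (splitHead n)
      ∘ₗ tensorRight (prodState fun i => pulse α (angle (t i))) ∘ₗ encode α
      ∘ₗ conj (rotZ (angle (-∑ i, t i)))))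
    + ∑ t₀ : ZMod 8, ((1 / 8 : ℝ) : ℂ) • (consMode n (multiPart α (angle t₀)) ∘ₗ simModes α n
      ∘ₗ conj (rotZ (angle (-t₀))))

theorem cpScaling_simModes (α : ℂ) (n : ℕ) : CPScaling 1 (simModes α n) := by
  induction n with
  | zero => exact CPScaling.measurePrepare fun _ => posTrace_ketbra _
  | succ n ih =>
    have hC := CPScaling.compress_bijective (splitHead_bijective (X := Fock) n)
    have h1 := CPScaling.sum Finset.univ fun (t : Fin n → ZMod 8) _ =>
      (hC.comp ((CPScaling.tensorRight (posTrace_prodState fun i =>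
        posTrace_pulse α (angle (t i)))).comp ((cpScaling_encode α).comp
          (cpScaling_conj_rotZ (-∑ i, t i))))).smul (show (0 : ℝ) ≤ 1 / 8 ^ n by positivity)
    have h2 := CPScaling.sum Finset.univ fun (t₀ : ZMod 8) _ =>
      ((hC.comp (CPScaling.tensorLeft (posTrace_multiPart α (angle t₀)))).comp
        (ih.comp (cpScaling_conj_rotZ (-t₀)))).smul (show (0 : ℝ) ≤ 1 / 8 by positivity)
    have h3 := h1.add h2
    have h4 : (∑ _t : Fin n → ZMod 8, (1 / 8 ^ n : ℝ) * (1 * (1 ^ n * ((1 - probMulti α) * 1)))) +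
        ∑ _t₀ : ZMod 8, (1 / 8 : ℝ) * (1 * probMulti α * (1 * 1)) = 1 := by
      simp [ZMod.card]
    rw [h4] at h3
    exact h3

/-- The simulated modes differ from the real ones only where all pulses contain at least two photons:
there, the angles are free instead of having the sum `φ`. The induction splits the first pulse. If it
contains at most one photon, its angle may be chosen last; otherwise its angle is drawn uniformly and
the remaining pulses are treated alike. -/
theorem simModes_plus (α : ℂ) (n : ℕ) (φ : ZMod 8) :
    simModes α n (plus φ) + sumAverage (fun θ => multiPart α (angle θ)) n φ =
      sumAverage (fun θ => pulse α (angle θ)) n φ +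
        freeAverage (fun θ => multiPart α (angle θ)) n := by
  induction n generalizing φ with
  | zero =>
    have h : simModes α 0 (plus φ) = ketbra default := by
      have h1 : ∀ b, plus φ b b = 1 / 2 := fun b => by rw [plus, phase_mul_star]
      simp only [simModes, measurePrepare_apply, h1, Fintype.sum_bool, ← add_smul, add_halves,
        one_smul]
    simp [h, sumAverage, freeAverage, prodState_zero, add_comm]
  | succ n ih =>
    have ih' : ∀ φ, simModes α n (plus φ) = sumAverage (fun θ => pulse α (angle θ)) n φ +
        freeAverage (fun θ => multiPart α (angle θ)) n -
          sumAverage (fun θ => multiPart α (angle θ)) n φ := fun φ => eq_sub_of_add_eq (ih φ)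
    have h1 : simModes α (n + 1) (plus φ) =
        ∑ t : Fin n → ZMod 8, ((1 / 8 ^ n : ℝ) : ℂ) •
          consMode n (singlePart α (angle (φ - ∑ i, t i)))
            (prodState fun i => pulse α (angle (t i))) +
        ∑ t₀ : ZMod 8, ((1 / 8 : ℝ) : ℂ) •
          consMode n (multiPart α (angle t₀)) (simModes α n (plus (φ - t₀))) := by
      rw [simModes]
      simp only [LinearMap.add_apply, LinearMap.sum_apply, LinearMap.smul_apply,
        LinearMap.comp_apply, conj_rotZ_plus, encode_plus, ← sub_eq_add_neg]
      rfl
    rw [h1, ← sum_consMode_sumAverage (fun θ => singlePart α (angle θ))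
      (fun θ => pulse α (angle θ))]
    simp only [ih', map_sub, map_add, smul_sub, smul_add, Finset.sum_sub_distrib,
      Finset.sum_add_distrib, ← sumAverage_succ, ← freeAverage_succ]
    have h2 : sumAverage (fun θ => pulse α (angle θ)) (n + 1) φ =
        ∑ t₀, ((1 / 8 : ℝ) : ℂ) • consMode n (singlePart α (angle t₀))
          (sumAverage (fun θ => pulse α (angle θ)) n (φ - t₀)) +
        ∑ t₀, ((1 / 8 : ℝ) : ℂ) • consMode n (multiPart α (angle t₀))
          (sumAverage (fun θ => pulse α (angle θ)) n (φ - t₀)) := by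
      rw [sumAverage_succ, ← Finset.sum_add_distrib]
      refine Finset.sum_congr rfl fun t₀ _ => ?_
      rw [← smul_add, ← LinearMap.add_apply, ← consMode_add, ← pulse_eq]
    rw [h2, sumAverage_succ (fun θ => multiPart α (angle θ)),
      freeAverage_succ (fun θ => multiPart α (angle θ))]
    abel

/-! ### The simulator -/

/-- Measures the first qubit of a pair in the basis `|±⟩` and, on the outcome `-`, applies `Z` to
the second one. -/
def disentangle : Superop (Bool × Bool) Bool :=
  ∑ s : Bool, conj (Matrix.of fun y p =>
    if y = p.2 then (if s && xor p.1 p.2 then -1 else 1) / (Real.sqrt 2 : ℂ) else 0)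

theorem cpScaling_disentangle : CPScaling 1 disentangle := by
  refine CPScaling.kraus _ fun x x' => ?_
  refine (?_ : (if x = x' then ((1 : ℝ) : ℂ) else 0) = _) ▸ hasSum_fintype _
  obtain ⟨a, b⟩ := x
  obtain ⟨a', b'⟩ := x'
  cases a <;> cases b <;> cases a' <;> cases b' <;>
    simp [div_eq_mul_inv, inv_sqrt_two_mul_self] <;> norm_num

/-- The photon carries the angle of the emitted pair once it is separated from the spin. -/
theorem disentangle_emission_plus (φ : ZMod 8) :
    disentangle (conj emission (plus φ)) = plus φ := by
  ext b b'
  simp only [disentangle, LinearMap.sum_apply, Matrix.sum_apply]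
  rw [Fintype.sum_bool, conj_apply, conj_apply]
  simp only [Fintype.sum_prod_type, Fintype.sum_bool, conj_emission_apply, Matrix.of_apply]
  have h : ∀ z : ℂ, (Real.sqrt 2 : ℂ)⁻¹ * z * (Real.sqrt 2 : ℂ)⁻¹ = z / 2 := fun z => by
    rw [mul_right_comm, inv_sqrt_two_mul_self]
    ring
  cases b <;> cases b' <;> simp [div_eq_mul_inv] <;> rw [h] <;> ring

/-- From the output of the Blind Graph State Extender to the messages of the dishonest run: the
photon is separated from the spin and turned into pulses, and the bit is kept. On `Abort`, which the
resource never outputs, the prepared state is arbitrary. -/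
def prepare (α : ℂ) (n : ℕ) : Superop (BobOutput × Unit) ((Fin n → Fock) × Bool) :=
  ((measurePrepare fun _ : Unit => ketbra default) ∘ₗ compress fun _ : Unit => (none, ()))
    + ∑ b : Bool, (tensorRight (ketbra b) ∘ₗ simModes α n ∘ₗ disentangle)
      ∘ₗ compress fun q : Bool × Bool => (some (b, q), ())

theorem cpScaling_prepare (α : ℂ) (n : ℕ) : CPScaling 1 (prepare α n) := by
  let B : Option Bool → Type := fun o => o.elim Unit fun _ => Bool × Bool
  let e : (o : Option Bool) → B o → BobOutput × Unit
    | none, _ => (none, ())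
    | some b, q => (some (b, q), ())
  let Φ : (o : Option Bool) → Superop (B o) ((Fin n → Fock) × Bool)
    | none => (measurePrepare fun _ : Unit => ketbra default : Superop Unit _)
    | some b => (tensorRight (ketbra b) ∘ₗ simModes α n ∘ₗ disentangle : Superop (Bool × Bool) _)
  have he : (fun p : Σ o, B o => e p.1 p.2).Bijective := by
    refine Function.bijective_iff_has_inverse.2 ⟨fun
      | (none, _) => ⟨none, ()⟩
      | (some (b, q), _) => ⟨some b, q⟩, ?_, ?_⟩
    · rintro ⟨_ | b, q⟩ <;> rfl
    · rintro ⟨_ | ⟨b, q⟩, u⟩ <;> rfl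
  have h := CPScaling.blocks (c := 1) e he (Φ := Φ) fun
    | none => CPScaling.discard (posTrace_ketbra _)
    | some b => by
      have := (CPScaling.tensorRight (posTrace_ketbra b)).comp
        ((cpScaling_simModes α n).comp cpScaling_disentangle)
      rw [one_mul, one_mul] at this
      exact this
  rw [Fintype.sum_option] at h
  exact h

/-- The simulator inputs `|+⟩` for the spin and prepares all pulses before the first one is sent. -/
def simulator (α : ℂ) (n : ℕ) : Simulator (rounds n) Bool BobOutput where
  K := Unit
  prep := plus 0 ⊗ₖ ketbra ()
  strategy := (sendAll n).pre (prepare α n)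

theorem simulator_isPhysical (α : ℂ) (n : ℕ) : (simulator α n).IsPhysical := by
  refine ⟨?_, (sendAll_isPhysical n).pre (isCPTP_iff.2 (cpScaling_prepare α n))⟩
  have := (posTrace_plus 0).kronecker (posTrace_ketbra ())
  rw [mul_one] at this
  exact this.isDensity

/-! ### Security against a dishonest Bob -/

/-- On the angle `θ`, draws a uniform bit `m` and prepares `m` together with `σ ((-1)^m θ)`. -/
def mixBit {n : ℕ} (σ : ZMod 8 → Matrix (Fin n → Fock) (Fin n → Fock) ℂ) :
    Superop (ZMod 8) ((Fin n → Fock) × Bool) :=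
  measurePrepare fun θ => ∑ m : Bool, ((1 / 2 : ℝ) : ℂ) • (σ (signed m θ) ⊗ₖ ketbra m)

theorem mixBit_add {n : ℕ} (σ τ : ZMod 8 → Matrix (Fin n → Fock) (Fin n → Fock) ℂ) :
    mixBit (fun φ => σ φ + τ φ) = mixBit σ + mixBit τ := by
  refine LinearMap.ext fun M => ?_
  simp only [mixBit, measurePrepare_apply, LinearMap.add_apply, Matrix.add_kronecker, smul_add,
    Finset.sum_add_distrib]

theorem cpScaling_mixBit {n : ℕ} {c : ℝ} {σ : ZMod 8 → Matrix (Fin n → Fock) (Fin n → Fock) ℂ}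
    (h : ∀ φ, PosTrace c (σ φ)) : CPScaling c (mixBit σ) := by
  refine CPScaling.measurePrepare fun θ => ?_
  have h1 := PosTrace.sum Finset.univ fun (m : Bool) _ =>
    ((h (signed m θ)).kronecker (posTrace_ketbra m)).smul (show (0 : ℝ) ≤ 1 / 2 by norm_num)
  have h2 : ∑ _m : Bool, 1 / 2 * (c * 1) = c := by
    rw [Fintype.sum_bool]
    ring
  rwa [h2] at h1

/-- On the spin `|+⟩`, the Blind Graph State Extender draws `b` with probability `1 / 2` and then yields
the same pair as an emission from the spin `|+_φ⟩`, where `φ = (-1)^b θ`. -/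
theorem extend_plus_block (θ : ZMod 8) (b : Bool) :
    compress (fun q : Bool × Bool => (some (b, q) : BobOutput)) (extend θ (plus 0)) =
      ((1 / 2 : ℝ) : ℂ) • conj emission (plus (signed b θ)) := by
  ext q q'
  rw [compress_apply, extend_some, Finset.sum_eq_single b]
  · simp [rotatedPair, conj_emission_apply, plus, phase_zero, div_eq_mul_inv, mul_assoc]
  · intro b' _ hb
    simp [rotatedPair, hb.symm]
  · simp

/-- The Blind Graph State Extender with the simulator sends the modes `simModes`. -/
theorem simulator_attach (α : ℂ) (n : ℕ) :
    (simulator α n).attach graphStateExtender =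
      (sendAll n).pre (mixBit fun φ => simModes α n (plus φ)) := by
  rw [Simulator.attach, simulator, Sender.pre_pre]
  congr 1
  refine LinearMap.ext fun M => ?_
  have h1 : compress (fun x : (ZMod 8 × Bool) × Unit => (x.1.1, (x.1.2, x.2)))
      (tensorRight (plus 0 ⊗ₖ ketbra ()) M) = (M ⊗ₖ plus 0) ⊗ₖ ketbra () := by
    ext p q
    simp [compress_apply, tensorRight_apply, mul_assoc]
  have h2 : graphStateExtender (M ⊗ₖ plus 0) = ∑ θ, M θ θ • extend θ (plus 0) := by
    rw [graphStateExtender_eq, LinearMap.sum_apply]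
    refine Finset.sum_congr rfl fun θ _ => ?_
    rw [LinearMap.comp_apply, ← map_smul]
    rfl
  have h3 : ∀ X : Matrix BobOutput BobOutput ℂ, X none none = 0 →
      prepare α n (X ⊗ₖ ketbra ()) = ∑ b : Bool, simModes α n (disentangle
        (compress (fun q : Bool × Bool => (some (b, q) : BobOutput)) X)) ⊗ₖ ketbra b := by
    intro X hX
    have h4 : ∀ b : Bool, compress (fun q : Bool × Bool => ((some (b, q) : BobOutput), ()))
        (X ⊗ₖ ketbra ()) = compress (fun q : Bool × Bool => (some (b, q) : BobOutput)) X := by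
      intro b
      ext q q'
      simp [compress_apply, ketbra_apply]
    have h5 : (measurePrepare fun _ : Unit => ketbra (default : (Fin n → Fock) × Bool))
        (compress (fun _ : Unit => ((none : BobOutput), ())) (X ⊗ₖ ketbra ())) = 0 := by
      simp [measurePrepare_apply, compress_apply, hX]
    simp only [prepare, LinearMap.add_apply, LinearMap.sum_apply, LinearMap.comp_apply, h4]
    rw [h5, zero_add]
    rfl
  have h6 : ∀ θ, prepare α n (extend θ (plus 0) ⊗ₖ ketbra ()) =
      ∑ m : Bool, ((1 / 2 : ℝ) : ℂ) • (simModes α n (plus (signed m θ)) ⊗ₖ ketbra m) := by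
    intro θ
    rw [h3 _ (extend_none θ _ _).1]
    simp only [extend_plus_block, map_smul, disentangle_emission_plus, Matrix.smul_kronecker]
  have h7 : ∀ X, prepare α n (X ⊗ₖ ketbra ()) =
      (prepare α n ∘ₗ tensorRight (ketbra ())) X := fun _ => rfl
  simp only [LinearMap.comp_apply]
  rw [h1, onLeft_kronecker, h2, h7, map_sum]
  simp only [map_smul]
  exact Finset.sum_congr rfl fun θ _ => congrArg _ (h6 θ)

/-- The messages of honest Alice amount to the modes `sumAverage` of the pulses. -/
theorem prob_alice_eq (α : ℂ) {n : ℕ} (hn : 1 ≤ n) {B : Type} (R : Responder (rounds n) B Bool)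
    (M : Matrix (ZMod 8 × B) (ZMod 8 × B) ℂ) :
    prob (alice α n) R M = prob (sendAll n) R
      (onLeft B (mixBit fun φ => sumAverage (fun θ => pulse α (angle θ)) n φ) M) := by
  obtain ⟨L, hL⟩ := exists_linear_prob (sendAll_finiteEnd n) R
  rw [prob_alice]
  simp only [prob_aliceSend]
  rw [mixBit, onLeft_measurePrepare]
  simp only [hL, ← Complex.re_sum, ← map_sum]
  congr 2
  refine Finset.sum_congr rfl fun θ _ => ?_
  ext p q
  simp only [sumAverage_eq hn, ← pulseAngles_signed, Matrix.sum_apply, Matrix.kroneckerMap_apply,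
    Matrix.smul_apply, smul_eq_mul, Finset.sum_mul, Finset.mul_sum]
  refine Finset.sum_congr rfl fun m _ => Finset.sum_congr rfl fun t _ => ?_
  push_cast
  field_simp

/-- The real and the simulated interaction differ only when all pulses contain at least two
photons. -/
theorem indist_simulator (α : ℂ) {n : ℕ} (hn : 1 ≤ n) :
    Indist (probMulti α ^ n) (alice α n) ((simulator α n).attach graphStateExtender) := by
  intro D hD
  rw [probOne_eq_prob, probOne_eq_prob, prob_alice_eq α hn, simulator_attach,
    prob_pre _ _ _ _ (rounds_ne_nil n)]
  set M := D.init
  have hM : PosTrace 1 M := hD.1.posTrace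
  have hmulti : ∀ θ, PosTrace (probMulti α) (multiPart α (angle θ)) :=
    fun θ => posTrace_multiPart α _
  have hbound : ∀ σ : ZMod 8 → Matrix (Fin n → Fock) (Fin n → Fock) ℂ,
      (∀ φ, PosTrace (probMulti α ^ n) (σ φ)) →
      0 ≤ prob (sendAll n) D.strategy (onLeft D.W (mixBit σ) M) ∧
        prob (sendAll n) D.strategy (onLeft D.W (mixBit σ) M) ≤ probMulti α ^ n := fun σ hσ => by
    have h := (cpScaling_mixBit hσ).posTrace_onLeft hM
    rw [mul_one] at h
    exact prob_bounds (sendAll_isPhysical n) hD.2 h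
  -- the difference of the two probabilities is that of two numbers in `[0, probMulti α ^ n]`
  have hB := hbound _ fun φ => posTrace_sumAverage hmulti hn φ
  have hC := hbound (fun _ => freeAverage (fun θ => multiPart α (angle θ)) n)
    fun _ => posTrace_freeAverage hmulti n
  obtain ⟨L, hL⟩ := exists_linear_prob (sendAll_finiteEnd n) D.strategy
  have key : ∀ σ τ : ZMod 8 → Matrix (Fin n → Fock) (Fin n → Fock) ℂ,
      prob (sendAll n) D.strategy (onLeft D.W (mixBit fun φ => σ φ + τ φ) M) =
        prob (sendAll n) D.strategy (onLeft D.W (mixBit σ) M) +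
          prob (sendAll n) D.strategy (onLeft D.W (mixBit τ) M) := fun σ τ => by
    rw [mixBit_add, onLeft_add, LinearMap.add_apply, hL, hL, hL, map_add, Complex.add_re]
  have h := key (fun φ => simModes α n (plus φ))
    (fun φ => sumAverage (fun θ => multiPart α (angle θ)) n φ)
  simp only [simModes_plus] at h
  rw [key] at h
  rw [abs_le]
  constructor <;> linarith [hB.1, hB.2, hC.1, hC.2]

end BlindGraph

end

theorem mainTheorem5 (α : ℂ) (η₁ : ℝ) (n : ℕ) (hn : 1 ≤ n)
    (𝓔 : BlindGraph.Superop (BlindGraph.Fock × Bool) (Bool × Option Bool))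
    (h𝓔 : BlindGraph.IsEmitter α η₁ 𝓔) :
    BlindGraph.Constructs (max (1 - η₁ ^ n) (BlindGraph.probMulti α ^ n))
      (BlindGraph.alice α n) (BlindGraph.bob 𝓔 n) BlindGraph.graphStateExtender :=
  ⟨fun D hD => (h𝓔.correctness hn D hD).trans (le_max_left _ _),
    BlindGraph.simulator α n, BlindGraph.simulator_isPhysical α n,
    fun D hD => (BlindGraph.indist_simulator α hn D hD).trans (le_max_right _ _)⟩
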